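/- **Setting.** Let $m,T\ge 1$ and $p\ge 0$ be integers, $\mathcal Y$ a standard Borel space, and $(Y_t(i))$, $1-p\le t\le T+1$, $1\le i\le m$, $\mathcal Y$-valued random variables on a probability space (arbitrary dependence across $t$ and $i$). The local examples of series $i$ are $Z_{i,t}=\big(Y_{t-p}^{t-1}(i),\,Y_t(i)\big)$, $1\le t\le T+1$, where $Y_a^b(i)=(Y_a(i),\dots,Y_b(i))$. Let $L:\mathcal Y\times\mathcal Y\to[0,M]$ be a measurable loss and $\mathcal H\neq\emptyset$ a set of measurable maps $h:\mathcal Y^p\to\mathcal Y$; write $f_h(x,y)=L(h(x),y)$ and $\mathcal F=\{f_h:h\in\mathcal H\}$. Assume that $\mathcal F$ is a measurable class: for all $n$ and $c\in\mathbb R^n$, the map $(z_1,\dots,z_n)\mapsto\sup_{h\in\mathcal H}\sum_k c_kf_h(z_k)$ is universally measurable (for example, $\mathcal F$ has a countable subset in which every element of $\mathcal F$ is a pointwise limit of a sequence). For each $i$ fix an information set $J_i\subseteq\{1,\dots,m\}$ with $i\in J_i$, for example $J_i=\{i\}$ (own history) or $J_i=\{1,\dots,m\}$ (history of all series). Put $W_{i,t}=(Z_{j,t})_{j\in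 J_i}$ and $\mathbb E_{i,t}[\,\cdot\,]=\mathbb E[\,\cdot\mid W_{i,1},\dots,W_{i,t}]$ (so $\mathbb E_{i,0}=\mathbb E$), computed for all $h$ simultaneously from one regular conditional distribution $\mathcal D_{i,t}$ of $W_{i,t+1}$ given $W_{i,1},\dots,W_{i,t}$. * Generalization gap: $$\Phi_{\rm loc}=\sup_{(h_1,\dots,h_m)\in\mathcal H^m}\Big[\frac1m\sum_{i=1}^m\mathbb E_{i,T}[f_{h_i}(Z_{i,T+1})]-\frac1{mT}\sum_{i=1}^m\sum_{t=1}^Tf_{h_i}(Z_{i,t})\Big].$$ * Discrepancy: $\displaystyle\Delta(\mathbf Z_i)=\sup_{h\in\mathcal H}\Big[\mathbb E_{i,T}[f_h(Z_{i,T+1})]-\frac1T\sum_{t=1}^T\mathbb E_{i,t-1}[f_h(Z_{i,t})]\Big].$ * Trees: a binary tree of depth $T$ with values in a set $E$ is a sequence of maps $v_t:\{\pm1\}^{t-1}\to E$, $1\le t\le T$; $v_t(\sigma)=v_t(\sigma_1,\dots,\sigma_{t-1})$ for $\sigma\in\{\pm1\}^T$. For a class $\mathcal G$ of real functions on $E$,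 $\mathcal N_1(\alpha,\mathcal G,v)$ is the least cardinality of a set $V$ of real-valued trees of depth $T$ such that for all $g\in\mathcal G$ and $\sigma\in\{\pm1\}^T$ there is $u\in V$ with $\frac1T\sum_{t=1}^T|u_t(\sigma)-g(v_t(\sigma))|\le\alpha$. * $T(\mathbf Z_i)$ is the law of the following random tree: at each node, given the history of values on the path to it, draw an independent pair $(W,W')$ from the conditional law of the next $W_{i,t}$ given that history (the regular conditional distribution above); label the node by $W$; the history is extended by $W$ for the child in direction $+1$ and by $W'$ for the child in direction $-1$, and the two subtrees are grown independently. Members of $\mathcal F$ are evaluated on the $i$-th coordinate of a label. **Theorem.** For every $\delta>0$, with probability at least $1-\delta$ the following holds for all $\alpha>0$ simultaneously: $$\Phi_{\rm loc}\le\frac1m\sum_{i=1}^m\Delta(\mathbf Z_i)+2\alpha+M\sqrt{\frac2T\log\frac{m\,\max_{1\le i\le m}\mathbb E_{v\sim T(\mathbf Z_i)}[\mathcal N_1(\alpha,\mathcal F,v)]}{\delta}}.$$ In particular, if $L$ takes values in $[0,1]$ the factor $M$ can be dropped. (If the event is not measurable, "probability at least $1-\delta$" means that its complement has outer probability at most $\delta$.)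 -/

import Mathlib

open MeasureTheory ProbabilityTheory

noncomputable section

namespace LocalForecast

/-! ### Complete binary trees -/

/-- An `E`-valued complete binary tree of depth `n`: a sequence of `n` maps
`z_t : {±1}^t → E`, `t = 0, …, n - 1` (the sign `+1` is `true`, the sign `-1` is `false`). -/
abbrev BinTree (E : Type*) (n : ℕ) : Type _ := (t : Fin n) → (Fin t → Bool) → E

/-- The value `z_t(σ) = z_t(σ_0, …, σ_{t-1})` along the path `σ`. -/
def BinTree.along {E : Type*} {n : ℕ} (z : BinTree E n) (σ : Fin n → Bool) (t : Fin n) : E :=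
  z t (fun s => σ (Fin.castLE t.isLt.le s))

/-- The tree with root label `a`, whose child in direction `+1` is `l` and whose child in
direction `-1` is `r`. -/
def BinTree.graft {E : Type*} {n : ℕ} (a : E) (l r : BinTree E n) : BinTree E (n + 1) :=
  Fin.cases (motive := fun t => (Fin t → Bool) → E) (fun _ => a)
    (fun s (σ : Fin (s + 1) → Bool) =>
      if σ 0 then l s (fun k => σ k.succ) else r s (fun k => σ k.succ))

/-! ### Sequential covering numbers -/

/-- `V` is a sequential `α`-cover, in the normalized `ℓ¹` norm, of the class `F` on the tree `z`. -/
def IsSeqCover {E : Type*} {n : ℕ} (α : ℝ) (F : Set (E → ℝ)) (z : BinTree E n)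
    (V : Set (BinTree ℝ n)) : Prop :=
  ∀ f ∈ F, ∀ σ : Fin n → Bool, ∃ v ∈ V,
    (1 / (n : ℝ)) * ∑ t : Fin n, |v.along σ t - f (z.along σ t)| ≤ α

/-- The sequential covering number `𝒩₁(α, F, z)`. -/
def seqCoveringNumber {E : Type*} {n : ℕ} (α : ℝ) (F : Set (E → ℝ)) (z : BinTree E n) : ℕ∞ :=
  ⨅ (V : Set (BinTree ℝ n)) (_ : IsSeqCover α F z V), V.encard

/-! ### The random tree generated by a process -/

section Tree

variable {E : Type*} [MeasurableSpace E]

lemma measurable_snoc_fst (t : ℕ) : Measurable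
    (fun x : (Fin t → E) × (E × E) => (Fin.snoc (α := fun _ => E) x.1 x.2.1 : Fin (t + 1) → E)) := by
  refine measurable_pi_lambda _ (fun k => ?_)
  refine Fin.lastCases ?_ (fun k => ?_) k
  · simpa using measurable_snd.fst
  · simpa using! (measurable_pi_apply k).comp measurable_fst

lemma measurable_snoc_snd (t : ℕ) : Measurable
    (fun x : (Fin t → E) × (E × E) => (Fin.snoc (α := fun _ => E) x.1 x.2.2 : Fin (t + 1) → E)) := by
  refine measurable_pi_lambda _ (fun k => ?_)
  refine Fin.lastCases ?_ (fun k => ?_) k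
  · simpa using measurable_snd.snd
  · simpa using! (measurable_pi_apply k).comp measurable_fst

/-- Given transition kernels `κ t` (the law of the observation at time `t` given those at times
`0, …, t - 1`) and a history of length `t`, the law of the depth-`n` tree of pairs grown from that
history: at the root a pair `(a, a')` is drawn independently from `κ t` given the history, the
child in direction `+1` is grown from the history extended by `a`, and the child in direction `-1`
is grown independently from the history extended by `a'`. -/
def pairTreeLaw (κ : (t : ℕ) → Kernel (Fin t → E) E) :
    (n t : ℕ) → Kernel (Fin t → E) (BinTree (E × E) n)
  | 0, _ => Kernel.const _ (Measure.dirac (fun t => t.elim0))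
  | n + 1, t =>
    ((κ t ×ₖ κ t) ⊗ₖ
      (((pairTreeLaw κ n (t + 1)).comap _ (measurable_snoc_fst t)) ×ₖ
        ((pairTreeLaw κ n (t + 1)).comap _ (measurable_snoc_snd t)))).map
      (fun x => BinTree.graft x.1 x.2.1 x.2.2)

/-- The tree `z` of first components of a tree of pairs. -/
def BinTree.fst {n : ℕ} (w : BinTree (E × E) n) : BinTree E n := fun t s => (w t s).1

end Tree

/-! ### Conditional laws of a process given its own past -/

section CondLaws

variable {Ω E : Type*} [MeasurableSpace Ω] [MeasurableSpace E] [StandardBorelSpace E] [Nonempty E]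

/-- A regular conditional distribution of `W_t` given `(W_0, …, W_{t-1})`. -/
def condLaw (μ : Measure Ω) [IsFiniteMeasure μ] (W : ℕ → Ω → E) (t : ℕ) :
    Kernel (Fin t → E) E :=
  condDistrib (W t) (fun ω (s : Fin t) => W s ω) μ

/-- The conditional expectation `𝔼[f(W_t) | W_0, …, W_{t-1}]`, as a function of `ω`. -/
def condMean (μ : Measure Ω) [IsFiniteMeasure μ] (W : ℕ → Ω → E) (f : E → ℝ) (t : ℕ) (ω : Ω) : ℝ :=
  ∫ w, f w ∂(condLaw μ W t (fun s : Fin t => W s ω))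

/-- The law `T(W)` of the random depth-`n` tree generated by the process `W`. -/
def treeLaw (μ : Measure Ω) [IsFiniteMeasure μ] (W : ℕ → Ω → E) (n : ℕ) :
    Measure (BinTree E n) :=
  (pairTreeLaw (condLaw μ W) n 0 (fun k => k.elim0)).map BinTree.fst

/-- The expected sequential covering number `𝔼_{v ∼ T(W)}[𝒩₁(α, F, v)]`. -/
def expCovering (μ : Measure Ω) [IsFiniteMeasure μ] (W : ℕ → Ω → E) (n : ℕ) (α : ℝ)
    (F : Set (E → ℝ)) : ℝ :=
  (∫⁻ v, (seqCoveringNumber α F v : ENNReal) ∂(treeLaw μ W n)).toReal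

end CondLaws

/-! ### Local models -/

section Local

variable {Ω 𝒴 : Type*} [MeasurableSpace Ω] [MeasurableSpace 𝒴] {m : ℕ}

/-- The local training example number `t + 1` of series `i`, that is
`((Y_{t+1-p}(i), …, Y_t(i)), Y_{t+1}(i))`. -/
def localExample (p : ℕ) (Y : ℤ → Fin m → Ω → 𝒴) (i : Fin m) (t : ℕ) (ω : Ω) :
    (Fin p → 𝒴) × 𝒴 :=
  (fun k => Y ((t : ℤ) + 1 - p + (k : ℕ)) i ω, Y ((t : ℤ) + 1) i ω)

/-- The local training examples, at a common time, of all the series in `J`. -/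
def infoProcess (p : ℕ) (Y : ℤ → Fin m → Ω → 𝒴) (J : Finset (Fin m)) (t : ℕ) (ω : Ω) :
    J → (Fin p → 𝒴) × 𝒴 :=
  fun j => localExample p Y j t ω

/-- The loss `f(h, (x, y)) = L(h(x), y)` of a hypothesis. -/
def loss {p : ℕ} (L : 𝒴 → 𝒴 → ℝ) (h : (Fin p → 𝒴) → 𝒴) (z : (Fin p → 𝒴) × 𝒴) : ℝ :=
  L (h z.1) z.2

/-- The loss of a hypothesis on the example of series `i`. -/
def lossAt {p : ℕ} (L : 𝒴 → 𝒴 → ℝ) {J : Finset (Fin m)} {i : Fin m} (hi : i ∈ J)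
    (h : (Fin p → 𝒴) → 𝒴) (w : J → (Fin p → 𝒴) × 𝒴) : ℝ :=
  loss L h (w ⟨i, hi⟩)

/-- The class of losses of the hypotheses in `H` is universally measurable: every supremum of
linear combinations of its values at finitely many points is. -/
def IsMeasurableLossClass {p : ℕ} (L : 𝒴 → 𝒴 → ℝ) (H : Set ((Fin p → 𝒴) → 𝒴)) : Prop :=
  ∀ (n : ℕ) (c : Fin n → ℝ) (ν : Measure (Fin n → (Fin p → 𝒴) × 𝒴)) [IsProbabilityMeasure ν],
    AEMeasurable (fun x => ⨆ h : H, ∑ k, c k * loss L (h : (Fin p → 𝒴) → 𝒴) (x k)) ν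

/-- The empirical error of `(h_1, …, h_m)` on the local samples of length `T`. -/
def empError {p : ℕ} (T : ℕ) (L : 𝒴 → 𝒴 → ℝ) (Y : ℤ → Fin m → Ω → 𝒴)
    (h : Fin m → (Fin p → 𝒴) → 𝒴) (ω : Ω) : ℝ :=
  (1 / ((m : ℝ) * T)) * ∑ i, ∑ t ∈ Finset.range T, loss L (h i) (localExample p Y i t ω)

variable [StandardBorelSpace 𝒴] [Nonempty 𝒴]

/-- The generalization error of `(h_1, …, h_m)`: the average over `i` of the conditional
expectation of the loss of `h_i` on the next example of series `i`, given the examples up to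
time `T` of the series in `J i`. -/
def genError {p : ℕ} (μ : Measure Ω) [IsFiniteMeasure μ] (T : ℕ) (L : 𝒴 → 𝒴 → ℝ)
    (Y : ℤ → Fin m → Ω → 𝒴) {J : Fin m → Finset (Fin m)} (hJ : ∀ i, i ∈ J i)
    (h : Fin m → (Fin p → 𝒴) → 𝒴) (ω : Ω) : ℝ :=
  (1 / (m : ℝ)) * ∑ i, condMean μ (infoProcess p Y (J i)) (lossAt L (hJ i) (h i)) T ω

/-- The generalization gap `Φ_loc`, a supremum over `(h_1, …, h_m) ∈ H^m`. -/
def gapLoc {p : ℕ} (μ : Measure Ω) [IsFiniteMeasure μ] (T : ℕ) (L : 𝒴 → 𝒴 → ℝ)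
    (Y : ℤ → Fin m → Ω → 𝒴) {J : Fin m → Finset (Fin m)} (hJ : ∀ i, i ∈ J i)
    (H : Set ((Fin p → 𝒴) → 𝒴)) (ω : Ω) : ℝ :=
  ⨆ h : Fin m → H, (genError μ T L Y hJ (fun i => (h i : (Fin p → 𝒴) → 𝒴)) ω
    - empError T L Y (fun i => (h i : (Fin p → 𝒴) → 𝒴)) ω)

/-- The discrepancy `Δ(Z_i)` of series `i`, with conditioning on the series in `J`. -/
def discrepancy {p : ℕ} (μ : Measure Ω) [IsFiniteMeasure μ] (T : ℕ) (L : 𝒴 → 𝒴 → ℝ)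
    (Y : ℤ → Fin m → Ω → 𝒴) {J : Finset (Fin m)} {i : Fin m} (hi : i ∈ J)
    (H : Set ((Fin p → 𝒴) → 𝒴)) (ω : Ω) : ℝ :=
  ⨆ h : H, (condMean μ (infoProcess p Y J) (lossAt L hi (h : (Fin p → 𝒴) → 𝒴)) T ω
    - (1 / (T : ℝ)) * ∑ t ∈ Finset.range T,
        condMean μ (infoProcess p Y J) (lossAt L hi (h : (Fin p → 𝒴) → 𝒴)) t ω)

/-- The expected sequential covering number of the losses of `H` on the tree generated by the
examples of series `i`, with conditioning on the series in `J`. -/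
def localCovering {p : ℕ} (μ : Measure Ω) [IsFiniteMeasure μ] (T : ℕ) (L : 𝒴 → 𝒴 → ℝ)
    (Y : ℤ → Fin m → Ω → 𝒴) {J : Finset (Fin m)} {i : Fin m} (hi : i ∈ J)
    (H : Set ((Fin p → 𝒴) → 𝒴)) (α : ℝ) : ℝ :=
  expCovering μ (infoProcess p Y J) T α (lossAt L hi '' H)

end Local

end LocalForecast

end

/-!
The gap exceeds the mean discrepancy by at most the average over the series `i` of
`sup_h (1/T) ∑ t, (𝔼[f_h(Z_t) | past] - f_h(Z_t))` (`gapLoc_le`), so by a union bound it suffices to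
bound the tail of this supremum for one series by
`𝔼[𝒩₁(α, F, v)] * exp (-T r² / (2 M²))` at the level `2 α + r`.

This is done through an exponential moment. By Jensen's inequality the conditional means are
replaced by a decoupled tangent sequence `Z'_t`, drawn independently given the path from the same
conditional laws (`exp_sum_seqMean_le`). Given the past, `Z_t` and `Z'_t` are exchangeable.
Exchanging them step by step at random shows that the pairs `(Z_t, Z'_t)` are distributed as the
pairs along a uniformly random path of the tree of pairs, up to the exchanges prescribed by the
signs of the path (`lintegral_path_decoupled`). Convexity of the exponential separates the two
members of the pairs, and reversing all signs identifies the law of the tree of second members with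
that of the tree of first members (`lintegral_pairTreeLaw_reflect`).

What remains is, for a fixed tree `v`, the
exponential moment of `sup_h ∑ t, -σ_t (f_h(v_t(σ)) - M/2)` over random signs; a cover reduces it to
`𝒩₁(α, F, v)` exponential moments of signed sums along a path of a tree with values in
`[-M/2, M/2]` (`sum_exp_signedSup_le`, `sum_exp_along_le`). Centring at `M/2` is what gives the
stated constant.

The hypothesis on the class only makes suprema of linear combinations of its values universally
measurable. These are the only functions whose integrals are rearranged; neither the supremum
involving the conditional means nor the covering number has to be measurable. The former is bounded
pointwise by an integral of a universally measurable function, and the latter occurs only as an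
upper bound under a (lower) Lebesgue integral. Covering numbers are bounded uniformly in the tree
(`exists_seqCoveringNumber_le`), so their expectation is finite. Finally, the bound for all `α` at
once holds since the right-hand side differs from the mean discrepancy by a deterministic amount,
whose infimum over `α` is the limit of countably many of its values (`measure_exists_lt_le`).
-/

namespace LocalForecast

/-! ### Universal measurability -/

/-- A map is universally measurable if it is almost everywhere measurable for every probability
measure on its domain. -/
def UniversallyMeasurable {α β : Type*} [MeasurableSpace α] [MeasurableSpace β] (f : α → β) :
    Prop :=
  ∀ ν : Measure α, IsProbabilityMeasure ν → AEMeasurable f ν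

namespace UniversallyMeasurable

open scoped ENNReal

variable {α β γ : Type*} [MeasurableSpace α] [MeasurableSpace β] [MeasurableSpace γ]

lemma of_measurable {f : α → β} (hf : Measurable f) : UniversallyMeasurable f :=
  fun _ _ => hf.aemeasurable

lemma comp_measurable {f : β → γ} {g : α → β} (hf : UniversallyMeasurable f) (hg : Measurable g) :
    UniversallyMeasurable (fun a => f (g a)) := fun ν _ =>
  (hf (ν.map g) (Measure.isProbabilityMeasure_map hg.aemeasurable)).comp_measurable hg

lemma measurable_comp {f : α → β} {g : β → γ} (hg : Measurable g) (hf : UniversallyMeasurable f) :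
    UniversallyMeasurable (fun a => g (f a)) := fun ν hν => hg.comp_aemeasurable (hf ν hν)

lemma lintegral_kernel {f : α × β → ℝ≥0∞} (hf : UniversallyMeasurable f) (κ : Kernel α β)
    [IsMarkovKernel κ] : UniversallyMeasurable (fun a => ∫⁻ b, f (a, b) ∂κ a) := by
  intro ν _
  have h := hf (ν ⊗ₘ κ) inferInstance
  refine ⟨fun a => ∫⁻ b, h.mk f (a, b) ∂κ a, h.measurable_mk.lintegral_kernel_prod_right', ?_⟩
  filter_upwards [Measure.ae_ae_of_ae_compProd h.ae_eq_mk] with a ha using lintegral_congr_ae ha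

lemma lintegral_lintegral_swap {f : α → β → ℝ≥0∞}
    (hf : UniversallyMeasurable (Function.uncurry f)) (ν : Measure α) (η : Measure β)
    [IsProbabilityMeasure ν] [IsProbabilityMeasure η] :
    ∫⁻ a, ∫⁻ b, f a b ∂η ∂ν = ∫⁻ b, ∫⁻ a, f a b ∂ν ∂η :=
  MeasureTheory.lintegral_lintegral_swap (hf _ inferInstance)

lemma lintegral_prod {f : α × β → ℝ≥0∞} (hf : UniversallyMeasurable f) (ν : Measure α)
    (η : Measure β) [IsProbabilityMeasure ν] [IsProbabilityMeasure η] :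
    ∫⁻ q, f q ∂(ν.prod η) = ∫⁻ a, ∫⁻ b, f (a, b) ∂η ∂ν :=
  MeasureTheory.lintegral_prod f (hf _ inferInstance)

end UniversallyMeasurable

/-! ### Tuples and trees -/

section Tuples

variable {α E : Type*} [MeasurableSpace α] [MeasurableSpace E]

@[fun_prop]
lemma measurable_finCons {n : ℕ} {f : α → E} {g : α → Fin n → E} (hf : Measurable f)
    (hg : Measurable g) :
    Measurable (fun x => (Fin.cons (f x) (g x) : Fin (n + 1) → E)) := by
  refine measurable_pi_lambda _ (fun k => Fin.cases ?_ (fun k => ?_) k)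
  · simpa using hf
  · simpa using! (measurable_pi_apply k).comp hg

@[fun_prop]
lemma measurable_finSnoc {n : ℕ} {f : α → Fin n → E} {g : α → E} (hf : Measurable f)
    (hg : Measurable g) :
    Measurable (fun x => (Fin.snoc (α := fun _ => E) (f x) (g x) : Fin (n + 1) → E)) := by
  refine measurable_pi_lambda _ (fun k => Fin.lastCases ?_ (fun k => ?_) k)
  · simpa using hg
  · simpa using! (measurable_pi_apply k).comp hf

@[fun_prop]
lemma measurable_finTail {n : ℕ} {f : α → Fin (n + 1) → E} (hf : Measurable f) :
    Measurable (fun x => (Fin.tail (f x) : Fin n → E)) :=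
  measurable_pi_lambda _ (fun k => (measurable_pi_apply k.succ).comp hf)

/-- A sum over sign sequences splits according to the first sign. -/
lemma sum_signs_succ {A : Type*} [AddCommMonoid A] {n : ℕ} (g : (Fin (n + 1) → Bool) → A) :
    ∑ σ, g σ = ∑ σ : Fin n → Bool, g (Fin.cons true σ) + ∑ σ : Fin n → Bool,
      g (Fin.cons false σ) := by
  rw [← (Fin.consEquiv (fun _ : Fin (n + 1) => Bool)).sum_comp, Fintype.sum_prod_type,
    Fintype.sum_bool]
  rfl

end Tuples

namespace BinTree

variable {E : Type*} {n : ℕ}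

lemma along_graft_true (a : E) (l r : BinTree E n) (σ : Fin n → Bool) :
    (graft a l r).along (Fin.cons true σ) = Fin.cons a (l.along σ) := by
  funext t
  refine Fin.cases rfl (fun s => ?_) t
  rfl

lemma along_graft_false (a : E) (l r : BinTree E n) (σ : Fin n → Bool) :
    (graft a l r).along (Fin.cons false σ) = Fin.cons a (r.along σ) := by
  funext t
  refine Fin.cases rfl (fun s => ?_) t
  rfl

@[fun_prop]
lemma measurable_along [MeasurableSpace E] (σ : Fin n → Bool) :
    Measurable (fun z : BinTree E n => z.along σ) :=
  measurable_pi_lambda _ fun _ => (measurable_pi_apply _).comp (measurable_pi_apply _)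

lemma measurable_graft [MeasurableSpace E] :
    Measurable (fun x : E × (BinTree E n × BinTree E n) => graft x.1 x.2.1 x.2.2) := by
  refine measurable_pi_lambda _ fun t => measurable_pi_lambda _ fun s => ?_
  induction t using Fin.cases with
  | zero => exact measurable_fst
  | succ t =>
    change Measurable (fun x : E × (BinTree E n × BinTree E n) =>
      if s (0 : Fin (t + 1)) then x.2.1 t (fun k => s k.succ) else x.2.2 t (fun k => s k.succ))
    by_cases h : s (0 : Fin (t + 1))
    · simp only [h, if_true]
      exact (measurable_pi_apply _).comp ((measurable_pi_apply t).comp measurable_snd.fst)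
    · simp only [h]
      exact (measurable_pi_apply _).comp ((measurable_pi_apply t).comp measurable_snd.snd)

/-- The reflection of a tree of pairs: all signs are reversed and the two components of every label
are exchanged. -/
def reflect (w : BinTree (E × E) n) : BinTree (E × E) n := fun t s => (w t (fun k => !s k)).swap

lemma measurable_reflect [MeasurableSpace E] :
    Measurable (reflect : BinTree (E × E) n → BinTree (E × E) n) :=
  measurable_pi_lambda _ fun t => measurable_pi_lambda _ fun _ =>
    measurable_swap.comp ((measurable_pi_apply _).comp (measurable_pi_apply t))

lemma measurable_fst [MeasurableSpace E] :
    Measurable (fst : BinTree (E × E) n → BinTree E n) :=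
  measurable_pi_lambda _ fun t => measurable_pi_lambda _ fun _ =>
    _root_.measurable_fst.comp ((measurable_pi_apply _).comp (measurable_pi_apply t))

lemma reflect_graft (a : E × E) (l r : BinTree (E × E) n) :
    reflect (graft a l r) = graft a.swap (reflect r) (reflect l) := by
  funext t s
  induction t using Fin.cases with
  | zero => rfl
  | succ t =>
    change (if !s (0 : Fin (t + 1)) then l t (fun k => !s k.succ)
        else r t (fun k => !s k.succ)).swap
      = if s (0 : Fin (t + 1)) then (r t (fun k => !s k.succ)).swap
        else (l t (fun k => !s k.succ)).swap
    cases s (0 : Fin (t + 1)) <;> rfl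

end BinTree

/-! ### The law of the tree of pairs -/

section PairTree

open scoped ENNReal

variable {E : Type*} [MeasurableSpace E] (κ : (t : ℕ) → Kernel (Fin t → E) E)
  [∀ t, IsMarkovKernel (κ t)]

instance isMarkovKernel_pairTreeLaw (n t : ℕ) : IsMarkovKernel (pairTreeLaw κ n t) := by
  induction n generalizing t with
  | zero => rw [pairTreeLaw]; infer_instance
  | succ n ih =>
    rw [pairTreeLaw]
    have := ih (t + 1)
    have h1 := Kernel.IsMarkovKernel.comap (pairTreeLaw κ n (t + 1))
      (measurable_snoc_fst (E := E) t)
    have h2 := Kernel.IsMarkovKernel.comap (pairTreeLaw κ n (t + 1))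
      (measurable_snoc_snd (E := E) t)
    exact Kernel.IsMarkovKernel.map _ BinTree.measurable_graft

lemma lintegral_pairTreeLaw_succ (n t : ℕ) (x : Fin t → E) {g : BinTree (E × E) (n + 1) → ℝ≥0∞}
    (hg : UniversallyMeasurable g) :
    ∫⁻ w, g w ∂(pairTreeLaw κ (n + 1) t x) =
      ∫⁻ a, ∫⁻ a', ∫⁻ l, ∫⁻ r, g (BinTree.graft (a, a') l r)
        ∂(pairTreeLaw κ n (t + 1) (Fin.snoc (α := fun _ => E) x a'))
        ∂(pairTreeLaw κ n (t + 1) (Fin.snoc (α := fun _ => E) x a)) ∂(κ t x) ∂(κ t x) := by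
  have hG := hg.comp_measurable (BinTree.measurable_graft (E := E × E) (n := n))
  have h1 := Kernel.IsMarkovKernel.comap (pairTreeLaw κ n (t + 1)) (measurable_snoc_fst (E := E) t)
  have h2 := Kernel.IsMarkovKernel.comap (pairTreeLaw κ n (t + 1)) (measurable_snoc_snd (E := E) t)
  rw [pairTreeLaw, Kernel.map_apply _ BinTree.measurable_graft,
    lintegral_map' (hg _ (Measure.isProbabilityMeasure_map
      BinTree.measurable_graft.aemeasurable)) BinTree.measurable_graft.aemeasurable,
    Kernel.lintegral_compProd₀ _ _ _ (hG _ inferInstance), Kernel.prod_apply,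
    UniversallyMeasurable.lintegral_prod]
  · refine lintegral_congr fun a => lintegral_congr fun a' => ?_
    rw [Kernel.prod_apply, UniversallyMeasurable.lintegral_prod]
    · rfl
    · exact hG.comp_measurable (g := fun q => ((a, a'), q)) (by fun_prop)
  · let η := ((pairTreeLaw κ n (t + 1)).comap _ (measurable_snoc_fst (E := E) t)) ×ₖ
        ((pairTreeLaw κ n (t + 1)).comap _ (measurable_snoc_snd (E := E) t))
    exact hG.lintegral_kernel (η.comap (fun q => (x, q)) (by fun_prop))

/-- The law of the tree of pairs is invariant under reflection: exchanging the two components of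
the labels exchanges the two children of every node. -/
lemma lintegral_pairTreeLaw_reflect (n t : ℕ) (x : Fin t → E) {g : BinTree (E × E) n → ℝ≥0∞}
    (hg : UniversallyMeasurable g) :
    ∫⁻ w, g w.reflect ∂(pairTreeLaw κ n t x) = ∫⁻ w, g w ∂(pairTreeLaw κ n t x) := by
  induction n generalizing t with
  | zero =>
    refine lintegral_congr fun w => congrArg g (funext fun k => k.elim0)
  | succ n ih =>
    have hG : UniversallyMeasurable (fun q : (E × E) × (BinTree (E × E) n × BinTree (E × E) n) =>
      g (BinTree.graft q.1 q.2.1 q.2.2)) := hg.comp_measurable BinTree.measurable_graft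
    have key : ∀ a a' : E,
        ∫⁻ l, ∫⁻ r, g (BinTree.reflect (BinTree.graft (a, a') l r))
          ∂(pairTreeLaw κ n (t + 1) (Fin.snoc (α := fun _ => E) x a'))
          ∂(pairTreeLaw κ n (t + 1) (Fin.snoc (α := fun _ => E) x a)) =
        ∫⁻ l, ∫⁻ r, g (BinTree.graft (a', a) l r)
          ∂(pairTreeLaw κ n (t + 1) (Fin.snoc (α := fun _ => E) x a))
          ∂(pairTreeLaw κ n (t + 1) (Fin.snoc (α := fun _ => E) x a')) := by
      intro a a'
      simp only [BinTree.reflect_graft, Prod.swap_prod_mk]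
      have e1 : ∀ l : BinTree (E × E) n, ∫⁻ r, g (BinTree.graft (a', a) r.reflect l.reflect)
            ∂(pairTreeLaw κ n (t + 1) (Fin.snoc (α := fun _ => E) x a')) =
          ∫⁻ r, g (BinTree.graft (a', a) r l.reflect)
            ∂(pairTreeLaw κ n (t + 1) (Fin.snoc (α := fun _ => E) x a')) := fun l =>
        ih (t + 1) _ (g := fun r => g (BinTree.graft (a', a) r l.reflect))
          (hG.comp_measurable (g := fun r => ((a', a), (r, l.reflect))) (by fun_prop))
      simp only [e1]
      have e2 := ih (t + 1) (Fin.snoc (α := fun _ => E) x a)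
        (g := fun l => ∫⁻ r, g (BinTree.graft (a', a) r l)
            ∂(pairTreeLaw κ n (t + 1) (Fin.snoc (α := fun _ => E) x a')))
        (UniversallyMeasurable.lintegral_kernel
          (f := fun q : BinTree (E × E) n × BinTree (E × E) n =>
            g (BinTree.graft (a', a) q.2 q.1))
          (hG.comp_measurable (g := fun q : BinTree (E × E) n × BinTree (E × E) n =>
            ((a', a), (q.2, q.1))) (by fun_prop))
          (Kernel.const _ (pairTreeLaw κ n (t + 1) (Fin.snoc (α := fun _ => E) x a'))))
      rw [e2]
      exact UniversallyMeasurable.lintegral_lintegral_swap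
        (hG.comp_measurable (g := fun q : BinTree (E × E) n × BinTree (E × E) n =>
            ((a', a), (q.2, q.1))) (by fun_prop)) _ _
    -- the two subtrees and the two members of the root label have changed places
    rw [lintegral_pairTreeLaw_succ κ n t x (hg.comp_measurable BinTree.measurable_reflect),
      lintegral_pairTreeLaw_succ κ n t x hg]
    simp only [key]
    refine UniversallyMeasurable.lintegral_lintegral_swap ?_ _ _
    have h1 := Kernel.IsMarkovKernel.comap (pairTreeLaw κ n (t + 1))
      (measurable_snoc_fst (E := E) t)
    have h2 := Kernel.IsMarkovKernel.comap (pairTreeLaw κ n (t + 1))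
      (measurable_snoc_snd (E := E) t)
    let η := ((pairTreeLaw κ n (t + 1)).comap _ (measurable_snoc_snd (E := E) t)) ×ₖ
        ((pairTreeLaw κ n (t + 1)).comap _ (measurable_snoc_fst (E := E) t))
    have h3 := (hG.comp_measurable (g := fun q : (E × E) × (BinTree (E × E) n ×
      BinTree (E × E) n) => ((q.1.2, q.1.1), q.2)) (by fun_prop)).lintegral_kernel
        (η.comap (fun q : E × E => (x, q)) (by fun_prop))
    convert h3 using 2 with q
    simp only [Function.uncurry, η, Kernel.comap_apply, Kernel.prod_apply]
    rw [UniversallyMeasurable.lintegral_prod]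
    exact hG.comp_measurable (g := fun p => ((q.2, q.1), p)) (by fun_prop)

end PairTree

/-! ### Paths, decoupled tangent sequences and symmetrization -/

section Pairs

variable {E : Type*}

/-- A pair, exchanged if the sign is `-1`. -/
def orient (b : Bool) (q : E × E) : E × E := if b then q else q.swap

lemma zip_cons {n : ℕ} (a a' : E) (y w : Fin n → E) :
    (fun s => ((Fin.cons a y : Fin (n + 1) → E) s, (Fin.cons a' w : Fin (n + 1) → E) s)) =
      (Fin.cons (a, a') (fun s => (y s, w s)) : Fin (n + 1) → E × E) := by
  funext s
  refine Fin.cases rfl (fun _ => rfl) s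

lemma orient_cons {n : ℕ} (b : Bool) (σ : Fin n → Bool) (q : E × E) (w : Fin n → E × E) :
    (fun s => orient ((Fin.cons b σ : Fin (n + 1) → Bool) s)
        ((Fin.cons q w : Fin (n + 1) → E × E) s)) =
      (Fin.cons (orient b q) (fun s => orient (σ s) (w s)) : Fin (n + 1) → E × E) := by
  funext s
  refine Fin.cases rfl (fun _ => rfl) s

end Pairs

section Decoupling

open scoped ENNReal

variable {E : Type*} [MeasurableSpace E] (κ : (t : ℕ) → Kernel (Fin t → E) E)

/-- The law of the next `n` observations, given a history of length `t`. -/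
noncomputable def pathLaw : (n t : ℕ) → Kernel (Fin t → E) (Fin n → E)
  | 0, _ => Kernel.const _ (Measure.dirac (fun k => k.elim0))
  | n + 1, t =>
    (κ t ⊗ₖ (pathLaw n (t + 1)).comap
        (fun q : (Fin t → E) × E => (Fin.snoc (α := fun _ => E) q.1 q.2 : Fin (t + 1) → E))
        (by fun_prop)).map
      (fun q => (Fin.cons q.1 q.2 : Fin (n + 1) → E))

/-- Given a history `x` of length `t` and the next `n` observations `y`, the law of the decoupled
tangent sequence: its terms are independent, and each of them is drawn from the conditional law of
the corresponding term of `y` given all the observations before it. -/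
noncomputable def decoupledLaw : (n t : ℕ) → Kernel ((Fin t → E) × (Fin n → E)) (Fin n → E)
  | 0, _ => Kernel.const _ (Measure.dirac (fun k => k.elim0))
  | n + 1, t =>
    (((κ t).comap (fun q : (Fin t → E) × (Fin (n + 1) → E) => q.1) measurable_fst) ×ₖ
      ((decoupledLaw n (t + 1)).comap
        (fun q : (Fin t → E) × (Fin (n + 1) → E) =>
          ((Fin.snoc (α := fun _ => E) q.1 (q.2 0) : Fin (t + 1) → E),
            (Fin.tail q.2 : Fin n → E)))
        (by fun_prop))).map
      (fun q => (Fin.cons q.1 q.2 : Fin (n + 1) → E))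

@[fun_prop]
lemma measurable_orient (b : Bool) : Measurable (orient b : E × E → E × E) := by
  cases b
  · exact measurable_swap
  · exact measurable_id

variable [∀ t, IsMarkovKernel (κ t)]

instance isMarkovKernel_pathLaw (n t : ℕ) : IsMarkovKernel (pathLaw κ n t) := by
  induction n generalizing t with
  | zero => rw [pathLaw]; infer_instance
  | succ n ih =>
    rw [pathLaw]
    have := ih (t + 1)
    exact Kernel.IsMarkovKernel.map _ (by fun_prop)

instance isMarkovKernel_decoupledLaw (n t : ℕ) : IsMarkovKernel (decoupledLaw κ n t) := by
  induction n generalizing t with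
  | zero => rw [decoupledLaw]; infer_instance
  | succ n ih =>
    rw [decoupledLaw]
    have := ih (t + 1)
    exact Kernel.IsMarkovKernel.map _ (by fun_prop)

lemma lintegral_pathLaw_succ (n t : ℕ) (x : Fin t → E) {g : (Fin (n + 1) → E) → ℝ≥0∞}
    (hg : UniversallyMeasurable g) :
    ∫⁻ y, g y ∂(pathLaw κ (n + 1) t x) =
      ∫⁻ a, ∫⁻ y, g (Fin.cons a y) ∂(pathLaw κ n (t + 1) (Fin.snoc (α := fun _ => E) x a))
        ∂(κ t x) := by
  have hm : Measurable (fun q : E × (Fin n → E) => (Fin.cons q.1 q.2 : Fin (n + 1) → E)) := by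
    fun_prop
  rw [pathLaw, Kernel.map_apply _ hm, lintegral_map' (hg _ (Measure.isProbabilityMeasure_map
      hm.aemeasurable)) hm.aemeasurable,
    Kernel.lintegral_compProd₀ _ _ _ (hg.comp_measurable hm _ inferInstance)]
  rfl

lemma lintegral_decoupledLaw_succ (n t : ℕ) (x : Fin t → E) (y : Fin (n + 1) → E)
    {g : (Fin (n + 1) → E) → ℝ≥0∞} (hg : UniversallyMeasurable g) :
    ∫⁻ w, g w ∂(decoupledLaw κ (n + 1) t (x, y)) =
      ∫⁻ a, ∫⁻ w, g (Fin.cons a w)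
        ∂(decoupledLaw κ n (t + 1) (Fin.snoc (α := fun _ => E) x (y 0), Fin.tail y))
        ∂(κ t x) := by
  have hm : Measurable (fun q : E × (Fin n → E) => (Fin.cons q.1 q.2 : Fin (n + 1) → E)) := by
    fun_prop
  rw [decoupledLaw, Kernel.map_apply _ hm, lintegral_map' (hg _ (Measure.isProbabilityMeasure_map
      hm.aemeasurable)) hm.aemeasurable, Kernel.prod_apply,
    UniversallyMeasurable.lintegral_prod (hg.comp_measurable hm)]
  rfl

/-- Symmetrization: a path together with its decoupled tangent sequence has the law of the pairs
read along a uniformly random path of the tree of pairs, the pairs being exchanged where the sign is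
`-1`. This holds since the two members of a pair are exchangeable given the history, and since the
history is extended by the first or the second of them according to the sign. -/
theorem lintegral_path_decoupled (n t : ℕ) (x : Fin t → E) {V : (Fin n → E × E) → ℝ≥0∞}
    (hV : UniversallyMeasurable V) :
    ∫⁻ y, ∫⁻ w, V (fun s => (y s, w s)) ∂(decoupledLaw κ n t (x, y)) ∂(pathLaw κ n t x) =
      (2⁻¹ : ℝ≥0∞) ^ n * ∑ σ : Fin n → Bool,
        ∫⁻ z, V (fun s => orient (σ s) (z.along σ s)) ∂(pairTreeLaw κ n t x) := by
  induction n generalizing t with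
  | zero =>
    have h : ∀ u v : Fin 0 → E × E, V u = V v := fun u v => congrArg V (Subsingleton.elim _ _)
    have hc : ∀ u, V u = V (fun k => k.elim0) := fun u => h _ _
    simp only [hc]
    simp
  | succ n ih =>
    -- the integral of the remaining steps, given the pair drawn first
    let B : E → E → ℝ≥0∞ := fun a a' =>
      ∫⁻ y, ∫⁻ w, V (Fin.cons (a, a') (fun s => (y s, w s)))
        ∂(decoupledLaw κ n (t + 1) (Fin.snoc (α := fun _ => E) x a, y))
        ∂(pathLaw κ n (t + 1) (Fin.snoc (α := fun _ => E) x a))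
    have hBm : UniversallyMeasurable (Function.uncurry B) := by
      have h1 : UniversallyMeasurable (fun q : ((E × E) × (Fin n → E)) × (Fin n → E) =>
          V (Fin.cons q.1.1 (fun s => (q.1.2 s, q.2 s)))) := hV.comp_measurable (by fun_prop)
      have h2 := h1.lintegral_kernel ((decoupledLaw κ n (t + 1)).comap
        (fun q : (E × E) × (Fin n → E) => ((Fin.snoc (α := fun _ => E) x q.1.1 :
          Fin (t + 1) → E), q.2)) (by fun_prop))
      exact h2.lintegral_kernel ((pathLaw κ n (t + 1)).comap
        (fun q : E × E => (Fin.snoc (α := fun _ => E) x q.1 : Fin (t + 1) → E)) (by fun_prop))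
    have hB : ∀ a a', B a a' = (2⁻¹ : ℝ≥0∞) ^ n * ∑ σ : Fin n → Bool,
        ∫⁻ z, V (Fin.cons (a, a') (fun s => orient (σ s) (z.along σ s)))
          ∂(pairTreeLaw κ n (t + 1) (Fin.snoc (α := fun _ => E) x a)) := fun a a' =>
      ih (t + 1) (Fin.snoc (α := fun _ => E) x a) (V := fun u => V (Fin.cons (a, a') u))
        (hV.comp_measurable (by fun_prop))
    have hleft : ∫⁻ y, ∫⁻ w, V (fun s => (y s, w s)) ∂(decoupledLaw κ (n + 1) t (x, y))
          ∂(pathLaw κ (n + 1) t x) = ∫⁻ a, ∫⁻ a', B a a' ∂(κ t x) ∂(κ t x) := by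
      rw [lintegral_pathLaw_succ]
      · refine lintegral_congr fun a => ?_
        have h1 : ∀ y : Fin n → E,
            ∫⁻ w, V (fun s => ((Fin.cons a y : Fin (n + 1) → E) s, w s))
              ∂(decoupledLaw κ (n + 1) t (x, Fin.cons a y)) =
            ∫⁻ a', ∫⁻ w, V (Fin.cons (a, a') (fun s => (y s, w s)))
              ∂(decoupledLaw κ n (t + 1) (Fin.snoc (α := fun _ => E) x a, y)) ∂(κ t x) := by
          intro y
          rw [lintegral_decoupledLaw_succ]
          · simp only [zip_cons]
            rfl
          · exact hV.comp_measurable (by fun_prop)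
        simp only [h1]
        refine UniversallyMeasurable.lintegral_lintegral_swap ?_ _ _
        have h2 : UniversallyMeasurable (fun q : ((Fin n → E) × E) × (Fin n → E) =>
          V (Fin.cons (a, q.1.2) (fun s => (q.1.1 s, q.2 s)))) := hV.comp_measurable (by fun_prop)
        exact h2.lintegral_kernel ((decoupledLaw κ n (t + 1)).comap
          (fun q : (Fin n → E) × E => ((Fin.snoc (α := fun _ => E) x a : Fin (t + 1) → E), q.1))
          (by fun_prop))
      · have h2 : UniversallyMeasurable (fun q : (Fin (n + 1) → E) × (Fin (n + 1) → E) =>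
          V (fun s => (q.1 s, q.2 s))) := hV.comp_measurable (by fun_prop)
        exact h2.lintegral_kernel ((decoupledLaw κ (n + 1) t).comap
          (fun q : Fin (n + 1) → E => (x, q)) (by fun_prop))
    have hs : ∀ (b : Bool) (σ : Fin n → Bool), UniversallyMeasurable
        (fun w : BinTree (E × E) (n + 1) => V (fun s =>
          orient ((Fin.cons b σ : Fin (n + 1) → Bool) s) (w.along (Fin.cons b σ) s))) := by
      intro b σ
      refine hV.comp_measurable (measurable_pi_lambda _ fun s => ?_)
      exact (measurable_orient _).comp ((measurable_pi_apply s).comp (BinTree.measurable_along _))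
    -- if the first sign is `+1`, only the subtree grown from the first member matters
    have htrue : ∀ σ : Fin n → Bool,
        ∫⁻ z, V (fun s => orient ((Fin.cons true σ : Fin (n + 1) → Bool) s)
          (z.along (Fin.cons true σ) s)) ∂(pairTreeLaw κ (n + 1) t x) =
        ∫⁻ a, ∫⁻ a', ∫⁻ z, V (Fin.cons (a, a') (fun s => orient (σ s) (z.along σ s)))
          ∂(pairTreeLaw κ n (t + 1) (Fin.snoc (α := fun _ => E) x a)) ∂(κ t x) ∂(κ t x) := by
      intro σ
      rw [lintegral_pairTreeLaw_succ κ n t x (hs true σ)]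
      simp only [BinTree.along_graft_true, orient_cons, lintegral_const, measure_univ, mul_one]
      rfl
    -- if it is `-1`, the root pair is exchanged, and only the subtree grown from `a'` matters
    have hfalse : ∀ σ : Fin n → Bool,
        ∫⁻ z, V (fun s => orient ((Fin.cons false σ : Fin (n + 1) → Bool) s)
          (z.along (Fin.cons false σ) s)) ∂(pairTreeLaw κ (n + 1) t x) =
        ∫⁻ a, ∫⁻ a', ∫⁻ z, V (Fin.cons (a', a) (fun s => orient (σ s) (z.along σ s)))
          ∂(pairTreeLaw κ n (t + 1) (Fin.snoc (α := fun _ => E) x a')) ∂(κ t x) ∂(κ t x) := by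
      intro σ
      rw [lintegral_pairTreeLaw_succ κ n t x (hs false σ)]
      simp only [BinTree.along_graft_false, orient_cons, lintegral_const, measure_univ, mul_one]
      rfl
    have hC : ∀ σ : Fin n → Bool, UniversallyMeasurable (fun q : E × E =>
        ∫⁻ z, V (Fin.cons (q.1, q.2) (fun s => orient (σ s) (z.along σ s)))
          ∂(pairTreeLaw κ n (t + 1) (Fin.snoc (α := fun _ => E) x q.1))) := by
      intro σ
      have h1 : UniversallyMeasurable (fun q : (E × E) × BinTree (E × E) n =>
          V (Fin.cons (q.1.1, q.1.2) (fun s => orient (σ s) (q.2.along σ s)))) := by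
        refine hV.comp_measurable (measurable_finCons (by fun_prop)
          (measurable_pi_lambda _ fun s => ?_))
        exact (measurable_orient _).comp ((measurable_pi_apply s).comp
          ((BinTree.measurable_along _).comp measurable_snd))
      exact h1.lintegral_kernel ((pairTreeLaw κ n (t + 1)).comap
        (fun q : E × E => (Fin.snoc (α := fun _ => E) x q.1 : Fin (t + 1) → E)) (by fun_prop))
    have hsum : ∫⁻ a, ∫⁻ a', B a a' ∂(κ t x) ∂(κ t x) = (2⁻¹ : ℝ≥0∞) ^ n * ∑ σ : Fin n → Bool,
        ∫⁻ a, ∫⁻ a', ∫⁻ z, V (Fin.cons (a, a') (fun s => orient (σ s) (z.along σ s)))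
          ∂(pairTreeLaw κ n (t + 1) (Fin.snoc (α := fun _ => E) x a)) ∂(κ t x) ∂(κ t x) := by
      have hp : (2⁻¹ : ℝ≥0∞) ^ n ≠ ∞ := by simp
      simp only [hB]
      have e1 : ∀ a, ∫⁻ a', (2⁻¹ : ℝ≥0∞) ^ n * ∑ σ : Fin n → Bool,
          ∫⁻ z, V (Fin.cons (a, a') (fun s => orient (σ s) (z.along σ s)))
            ∂(pairTreeLaw κ n (t + 1) (Fin.snoc (α := fun _ => E) x a)) ∂(κ t x) =
          (2⁻¹ : ℝ≥0∞) ^ n * ∑ σ : Fin n → Bool, ∫⁻ a',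
          ∫⁻ z, V (Fin.cons (a, a') (fun s => orient (σ s) (z.along σ s)))
            ∂(pairTreeLaw κ n (t + 1) (Fin.snoc (α := fun _ => E) x a)) ∂(κ t x) := by
        intro a
        rw [lintegral_const_mul' _ _ hp, lintegral_finsetSum' _ fun σ _ =>
          (hC σ).comp_measurable (g := fun a' => (a, a')) (by fun_prop) _ inferInstance]
      simp only [e1]
      rw [lintegral_const_mul' _ _ hp]
      exact congrArg _ (lintegral_finsetSum' _ fun σ _ =>
        (hC σ).lintegral_kernel (Kernel.const _ (κ t x)) _ inferInstance)
    rw [hleft, sum_signs_succ]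
    simp only [htrue, hfalse]
    -- the two cases agree, since `a` and `a'` are drawn independently from the same law
    have hfs : ∀ σ : Fin n → Bool,
        ∫⁻ a, ∫⁻ a', ∫⁻ z, V (Fin.cons (a', a) (fun s => orient (σ s) (z.along σ s)))
          ∂(pairTreeLaw κ n (t + 1) (Fin.snoc (α := fun _ => E) x a')) ∂(κ t x) ∂(κ t x) =
        ∫⁻ a, ∫⁻ a', ∫⁻ z, V (Fin.cons (a, a') (fun s => orient (σ s) (z.along σ s)))
          ∂(pairTreeLaw κ n (t + 1) (Fin.snoc (α := fun _ => E) x a)) ∂(κ t x) ∂(κ t x) :=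
      fun σ => (UniversallyMeasurable.lintegral_lintegral_swap (hC σ) (κ t x) (κ t x)).symm
    simp only [hfs]
    rw [pow_succ, mul_comm ((2⁻¹ : ℝ≥0∞) ^ n), mul_assoc, mul_add, ← hsum, mul_add, ← add_mul,
      ENNReal.inv_two_add_inv_two, one_mul]

end Decoupling

/-! ### Processes and their conditional means -/

section ConditionalLaws

open scoped ENNReal

lemma snoc_restrict {E : Type*} (w : ℕ → E) (t : ℕ) :
    (Fin.snoc (α := fun _ => E) (fun k : Fin t => w k) (w t) : Fin (t + 1) → E) =
      fun k : Fin (t + 1) => w k := by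
  funext k
  refine Fin.lastCases ?_ (fun k => ?_) k <;> simp

lemma cons_shift {E : Type*} (w : ℕ → E) (n t : ℕ) :
    (Fin.cons (w t) (fun s : Fin n => w (t + 1 + s)) : Fin (n + 1) → E) =
      fun s : Fin (n + 1) => w (t + s) := by
  funext s
  refine Fin.cases rfl (fun s => ?_) s
  simp only [Fin.cons_succ, Fin.val_succ]
  congr 1
  omega

variable {Ω E : Type*} [MeasurableSpace Ω] [MeasurableSpace E]

section CondLaw

variable [StandardBorelSpace E] [Nonempty E]

instance isMarkovKernel_condLaw (μ : Measure Ω) [IsFiniteMeasure μ] (W : ℕ → Ω → E) (t : ℕ) :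
    IsMarkovKernel (condLaw μ W t) := by
  unfold condLaw; infer_instance

/-- The law of the process is obtained by composing its conditional laws. -/
lemma lintegral_pathLaw_condLaw (μ : Measure Ω) [IsProbabilityMeasure μ] {W : ℕ → Ω → E}
    (hW : ∀ t, Measurable (W t)) (n t : ℕ) {g : (Fin t → E) × (Fin n → E) → ℝ≥0∞}
    (hg : UniversallyMeasurable g) :
    ∫⁻ ω, ∫⁻ y, g (fun k => W k ω, y) ∂(pathLaw (condLaw μ W) n t (fun k => W k ω)) ∂μ =
      ∫⁻ ω, g (fun k => W k ω, fun s => W (t + s) ω) ∂μ := by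
  induction n generalizing t with
  | zero =>
    have hc : ∀ (x : Fin t → E) (y : Fin 0 → E), g (x, y) = g (x, fun k => k.elim0) :=
      fun x y => congrArg (fun z => g (x, z)) (Subsingleton.elim _ _)
    refine lintegral_congr fun ω => ?_
    rw [hc _ (fun s : Fin 0 => W (t + s) ω)]
    simp only [hc (fun k : Fin t => W k ω)]
    simp
  | succ n ih =>
    let φ : (Fin t → E) × E → ℝ≥0∞ := fun q => ∫⁻ y, g (q.1, Fin.cons q.2 y)
      ∂(pathLaw (condLaw μ W) n (t + 1) (Fin.snoc (α := fun _ => E) q.1 q.2))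
    have hφ : UniversallyMeasurable φ :=
      (hg.comp_measurable (g := fun q : ((Fin t → E) × E) × (Fin n → E) =>
        (q.1.1, (Fin.cons q.1.2 q.2 : Fin (n + 1) → E))) (by fun_prop)).lintegral_kernel
        ((pathLaw (condLaw μ W) n (t + 1)).comap
          (fun q : (Fin t → E) × E => (Fin.snoc (α := fun _ => E) q.1 q.2 : Fin (t + 1) → E))
          (by fun_prop))
    have hp : Measurable (fun ω (k : Fin t) => W k ω) := measurable_pi_lambda _ fun k => hW k
    have : IsProbabilityMeasure (μ.map (fun ω (k : Fin t) => W k ω)) :=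
      Measure.isProbabilityMeasure_map hp.aemeasurable
    calc ∫⁻ ω, ∫⁻ y, g (fun k => W k ω, y)
          ∂(pathLaw (condLaw μ W) (n + 1) t (fun k => W k ω)) ∂μ
        = ∫⁻ ω, ∫⁻ a, φ (fun k => W k ω, a) ∂(condLaw μ W t (fun k => W k ω)) ∂μ :=
          lintegral_congr fun ω => lintegral_pathLaw_succ _ n t _
            (hg.comp_measurable (g := fun y => ((fun k : Fin t => W k ω), y)) (by fun_prop))
      _ = ∫⁻ x, ∫⁻ a, φ (x, a) ∂(condLaw μ W t x) ∂(μ.map (fun ω (k : Fin t) => W k ω)) :=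
          (lintegral_map' (hφ.lintegral_kernel _ _ inferInstance) hp.aemeasurable).symm
      _ = ∫⁻ q, φ q ∂((μ.map (fun ω (k : Fin t) => W k ω)) ⊗ₘ (condLaw μ W t)) :=
          (Kernel.lintegral_compProd₀ (Kernel.const Unit _) (Kernel.prodMkLeft Unit (condLaw μ W t))
            () (hφ _ inferInstance)).symm
      _ = ∫⁻ q, φ q ∂(μ.map (fun ω => ((fun k : Fin t => W k ω), W t ω))) := by
          rw [condLaw, compProd_map_condDistrib (hW t).aemeasurable]
      _ = ∫⁻ ω, φ ((fun k : Fin t => W k ω), W t ω) ∂μ :=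
          lintegral_map' (hφ _ (Measure.isProbabilityMeasure_map (hp.prodMk (hW t)).aemeasurable))
            (hp.prodMk (hW t)).aemeasurable
      _ = ∫⁻ ω, ∫⁻ y, g (fun k => W k ω, Fin.cons (W t ω) y)
            ∂(pathLaw (condLaw μ W) n (t + 1) (fun k => W k ω)) ∂μ := by
          refine lintegral_congr fun ω => ?_
          simp only [φ]
          rw [snoc_restrict (fun k => W k ω)]
      _ = ∫⁻ ω, g (fun k => W k ω, Fin.cons (W t ω) (fun s => W (t + 1 + s) ω)) ∂μ :=
          ih (t + 1) (g := fun q => g (fun k => q.1 k.castSucc, Fin.cons (q.1 (Fin.last t)) q.2))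
            (hg.comp_measurable (g := fun q : (Fin (t + 1) → E) × (Fin n → E) =>
              ((fun k : Fin t => q.1 k.castSucc), (Fin.cons (q.1 (Fin.last t)) q.2 :
                Fin (n + 1) → E))) (by fun_prop))
      _ = _ := by
          refine lintegral_congr fun ω => ?_
          rw [cons_shift (fun k => W k ω)]

end CondLaw

variable (κ : (t : ℕ) → Kernel (Fin t → E) E)

/-- The mean of `f` at time `t` under the transition kernels `κ`, given that the observations at
times `0, …, t - 1` are those of the sequence `w`. -/
noncomputable def seqMean (f : E → ℝ) (w : ℕ → E) (t : ℕ) : ℝ := ∫ a, f a ∂(κ t (fun k => w k))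

lemma exp_integral_le_lintegral (ν : Measure E) [IsProbabilityMeasure ν] {f : E → ℝ} {M : ℝ}
    (hf : Measurable f) (hfM : ∀ e, f e ∈ Set.Icc 0 M) (l b : ℝ) :
    ENNReal.ofReal (Real.exp (l * ((∫ a, f a ∂ν) - b))) ≤
      ∫⁻ a, ENNReal.ofReal (Real.exp (l * (f a - b))) ∂ν := by
  have hi : Integrable f ν := Integrable.of_mem_Icc 0 M hf.aemeasurable (.of_forall hfM)
  have hg : Integrable (fun a => l * (f a - b)) ν := (hi.sub (integrable_const b)).const_mul l
  have he : Integrable (fun a => Real.exp (l * (f a - b))) ν := by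
    refine Integrable.of_mem_Icc 0 (Real.exp (|l| * (M + |b|))) (by fun_prop)
      (.of_forall fun a => ⟨(Real.exp_pos _).le, Real.exp_le_exp.2 ?_⟩)
    obtain ⟨h0, h1⟩ := hfM a
    calc l * (f a - b) ≤ |l * (f a - b)| := le_abs_self _
      _ = |l| * |f a - b| := abs_mul _ _
      _ ≤ |l| * (|f a| + |b|) := by gcongr; exact abs_sub _ _
      _ ≤ |l| * (M + |b|) := by rw [abs_of_nonneg h0]; gcongr
  have hJ : Real.exp (∫ a, l * (f a - b) ∂ν) ≤ ∫ a, Real.exp (l * (f a - b)) ∂ν :=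
    convexOn_exp.map_integral_le Real.continuous_exp.continuousOn isClosed_univ (by simp) hg he
  rw [integral_const_mul, integral_sub hi (integrable_const b)] at hJ
  simp only [integral_const, probReal_univ, smul_eq_mul, one_mul] at hJ
  rw [← ofReal_integral_eq_lintegral_ofReal he (.of_forall fun a => (Real.exp_pos _).le)]
  exact ENNReal.ofReal_le_ofReal hJ

/-- Jensen's inequality replaces the conditional means by a decoupled tangent sequence. -/
lemma exp_sum_seqMean_le [∀ t, IsMarkovKernel (κ t)] {f : E → ℝ} {M : ℝ}
    (hf : Measurable f) (hfM : ∀ e, f e ∈ Set.Icc 0 M) (l : ℝ) (w : ℕ → E) (n t : ℕ) :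
    ENNReal.ofReal (Real.exp (l * ∑ s ∈ Finset.range n,
        (seqMean κ f w (t + s) - f (w (t + s))))) ≤
      ∫⁻ u, ENNReal.ofReal (Real.exp (l * ∑ s : Fin n, (f (u s) - f (w (t + s)))))
        ∂(decoupledLaw κ n t (fun k => w k, fun s => w (t + s))) := by
  induction n generalizing t with
  | zero => simp
  | succ n ih =>
    have hm : Measurable (fun u : Fin (n + 1) → E =>
        ENNReal.ofReal (Real.exp (l * ∑ s : Fin (n + 1), (f (u s) - f (w (t + s)))))) := by
      fun_prop
    have hcurry : (fun s : Fin n => w (t + (s.succ : Fin (n + 1)))) =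
        fun s : Fin n => w (t + 1 + s) := by
      funext s
      rw [Fin.val_succ]
      congr 1
      omega
    rw [lintegral_decoupledLaw_succ κ n t _ _ (.of_measurable hm)]
    have hR : ∫⁻ a, ∫⁻ u, ENNReal.ofReal (Real.exp (l * ∑ s : Fin (n + 1),
            (f ((Fin.cons a u : Fin (n + 1) → E) s) - f (w (t + s)))))
          ∂(decoupledLaw κ n (t + 1) (Fin.snoc (α := fun _ => E) (fun k => w k)
            (w (t + (0 : Fin (n + 1)))), Fin.tail (fun s : Fin (n + 1) => w (t + s))))
          ∂(κ t (fun k => w k)) =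
        (∫⁻ a, ENNReal.ofReal (Real.exp (l * (f a - f (w t)))) ∂(κ t (fun k => w k))) *
        ∫⁻ u, ENNReal.ofReal (Real.exp (l * ∑ s : Fin n, (f (u s) - f (w (t + 1 + s)))))
          ∂(decoupledLaw κ n (t + 1) (fun k => w k, fun s => w (t + 1 + s))) := by
      rw [Fin.val_zero, add_zero, snoc_restrict, show Fin.tail (fun s : Fin (n + 1) => w (t + s)) =
        fun s : Fin n => w (t + 1 + s) from hcurry, ← lintegral_mul_const _ (by fun_prop)]
      refine lintegral_congr fun a => ?_
      rw [← lintegral_const_mul _ (by fun_prop)]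
      refine lintegral_congr fun u => ?_
      rw [← ENNReal.ofReal_mul (Real.exp_pos _).le, ← Real.exp_add, Fin.sum_univ_succ, mul_add]
      simp only [Fin.cons_zero, Fin.cons_succ, Fin.val_zero, add_zero, congrFun hcurry]
    have hL : l * ∑ s ∈ Finset.range (n + 1), (seqMean κ f w (t + s) - f (w (t + s))) =
        l * (seqMean κ f w t - f (w t)) +
          l * ∑ s ∈ Finset.range n, (seqMean κ f w (t + 1 + s) - f (w (t + 1 + s))) := by
      rw [Finset.sum_range_succ', mul_add, add_comm]
      simp only [add_zero, add_assoc, add_comm 1]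
    rw [hL, Real.exp_add, ENNReal.ofReal_mul (Real.exp_pos _).le]
    exact (mul_le_mul' (exp_integral_le_lintegral _ hf hfM l _) (ih (t + 1))).trans_eq hR.symm

end ConditionalLaws

/-! ### Exponential moments and sequential covers -/

section Covers

/-- The real number `-σ` for a sign `σ ∈ {±1}` (as for trees, `true` is the sign `+1`). -/
def negSign (b : Bool) : ℝ := if b then -1 else 1

lemma abs_negSign (b : Bool) : |negSign b| = 1 := by cases b <;> simp [negSign]

/-- The subtree rooted at the child in direction `b` of the root. -/
def BinTree.child {E : Type*} {n : ℕ} (b : Bool) (u : BinTree E (n + 1)) : BinTree E n :=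
  fun t s => u t.succ (Fin.cons b s : Fin (t + 1) → Bool)

lemma BinTree.along_cons {E : Type*} {n : ℕ} (u : BinTree E (n + 1)) (b : Bool)
    (σ : Fin n → Bool) :
    u.along (Fin.cons b σ) = Fin.cons (u 0 (fun k => k.elim0)) ((u.child b).along σ) := by
  funext t
  refine Fin.cases ?_ (fun t => ?_) t
  · exact congrArg (u 0) (funext fun k => k.elim0)
  · refine congrArg (u t.succ) (funext fun s => ?_)
    refine Fin.cases (motive := fun s : Fin (t + 1) => (Fin.cons b σ : Fin (n + 1) → Bool)
      (Fin.castLE t.succ.isLt.le s) = (Fin.cons b (fun k : Fin t => σ (Fin.castLE t.isLt.le k)) :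
        Fin (t + 1) → Bool) s) rfl (fun _ => rfl) s

/-- The exponential moment of a signed sum along a uniformly random path of a bounded tree. -/
lemma sum_exp_along_le (l B : ℝ) (n : ℕ) (u : BinTree ℝ n) (hu : ∀ t s, |u t s| ≤ B) :
    ∑ σ : Fin n → Bool, Real.exp (l * ∑ s, negSign (σ s) * u.along σ s) ≤
      2 ^ n * Real.exp (n * (l ^ 2 * B ^ 2 / 2)) := by
  induction n with
  | zero => simp
  | succ n ih =>
    set a := u 0 (fun k => k.elim0)
    have h : ∀ b : Bool, ∑ σ : Fin n → Bool, Real.exp (l * ∑ s,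
        negSign ((Fin.cons b σ : Fin (n + 1) → Bool) s) * u.along (Fin.cons b σ) s) ≤
          Real.exp (l * (negSign b * a)) * (2 ^ n * Real.exp (n * (l ^ 2 * B ^ 2 / 2))) := by
      intro b
      refine le_trans (le_of_eq ?_) (mul_le_mul_of_nonneg_left
        (ih (u.child b) fun t s => hu _ _) (Real.exp_pos _).le)
      rw [Finset.mul_sum]
      refine Finset.sum_congr rfl fun σ _ => ?_
      rw [← Real.exp_add, BinTree.along_cons, Fin.sum_univ_succ, mul_add]
      simp only [Fin.cons_zero, Fin.cons_succ, a]
    rw [sum_signs_succ]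
    refine (add_le_add (h true) (h false)).trans ?_
    have hc : Real.exp (l * (negSign true * a)) + Real.exp (l * (negSign false * a)) ≤
        2 * Real.exp (l ^ 2 * B ^ 2 / 2) := by
      have h1 := Real.cosh_le_exp_half_sq (l * a)
      have h2 : Real.exp ((l * a) ^ 2 / 2) ≤ Real.exp (l ^ 2 * B ^ 2 / 2) := by
        rw [mul_pow]
        have : a ^ 2 ≤ B ^ 2 := sq_le_sq' (abs_le.1 (hu _ _)).1 (abs_le.1 (hu _ _)).2
        gcongr
      rw [Real.cosh_eq] at h1
      simp only [negSign, if_true, Bool.false_eq_true, if_false, neg_mul, one_mul, mul_neg]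
      linarith
    rw [← add_mul]
    refine (mul_le_mul_of_nonneg_right hc (by positivity)).trans (le_of_eq ?_)
    rw [Nat.cast_succ, add_mul, one_mul, Real.exp_add]
    ring

variable {E ι : Type*} {n : ℕ} {f : ι → E → ℝ} {M α l : ℝ}

/-- The supremum over the class of the signed, centred sums along the path `σ` of the tree `v`. -/
noncomputable def signedSup (f : ι → E → ℝ) (M : ℝ) (x : Fin n → E) (σ : Fin n → Bool) : ℝ :=
  ⨆ i, ∑ s, negSign (σ s) * (f i (x s) - M / 2)

lemma bddAbove_linear (hf : ∀ i e, f i e ∈ Set.Icc 0 M) (c : Fin n → ℝ) (x : Fin n → E) :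
    BddAbove (Set.range fun i => ∑ s, c s * f i (x s)) := by
  refine ⟨∑ s, |c s| * M, ?_⟩
  rintro _ ⟨i, rfl⟩
  refine Finset.sum_le_sum fun s _ => ?_
  obtain ⟨h0, h1⟩ := hf i (x s)
  exact (mul_le_mul_of_nonneg_right (le_abs_self _) h0).trans
    (mul_le_mul_of_nonneg_left h1 (abs_nonneg _))

lemma signedSup_eq [Nonempty ι] (hf : ∀ i e, f i e ∈ Set.Icc 0 M) (x : Fin n → E)
    (σ : Fin n → Bool) :
    signedSup f M x σ =
      (⨆ i, ∑ s, negSign (σ s) * f i (x s)) - ∑ s, negSign (σ s) * (M / 2) := by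
  rw [signedSup, ciSup_sub (bddAbove_linear hf _ _)]
  simp only [mul_sub, Finset.sum_sub_distrib]

lemma le_signedSup (hf : ∀ i e, f i e ∈ Set.Icc 0 M) (x : Fin n → E)
    (σ : Fin n → Bool) (i : ι) :
    ∑ s, negSign (σ s) * (f i (x s) - M / 2) ≤ signedSup f M x σ := by
  have : Nonempty ι := ⟨i⟩
  rw [signedSup_eq hf]
  simp only [mul_sub, Finset.sum_sub_distrib]
  exact sub_le_sub_right (le_ciSup (bddAbove_linear hf _ x) i) _

/-- The value `a` moved to `[0, M]`, and centred. -/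
noncomputable def centredClip (M a : ℝ) : ℝ := max 0 (min M a) - M / 2

lemma abs_centredClip_le (hM : 0 ≤ M) (a : ℝ) : |centredClip M a| ≤ M / 2 := by
  rw [centredClip, abs_le]
  constructor
  · linarith [le_max_left 0 (min M a)]
  · linarith [max_le hM (min_le_left M a)]

lemma sub_centredClip_le {b : ℝ} (hb : b ∈ Set.Icc 0 M) (a c : ℝ) (hc : |c| = 1) :
    c * (b - M / 2) - c * centredClip M a ≤ |a - b| := by
  have h1 : |max 0 (min M a) - b| ≤ |a - b| := by
    have e : b = max 0 (min M b) := by rw [min_eq_right hb.2, max_eq_right hb.1]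
    calc |max 0 (min M a) - b| = |max 0 (min M a) - max 0 (min M b)| := by rw [← e]
      _ ≤ |min M a - min M b| := by
          simpa using abs_max_sub_max_le_max 0 (min M a) 0 (min M b)
      _ ≤ |a - b| := by simpa using abs_min_sub_min_le_max M a M b
  calc c * (b - M / 2) - c * centredClip M a ≤ |c * (b - M / 2) - c * centredClip M a| :=
        le_abs_self _
    _ = |max 0 (min M a) - b| := by
        rw [← mul_sub, abs_mul, hc, one_mul, abs_sub_comm, centredClip]
        congr 1
        ring
    _ ≤ |a - b| := h1

/-- A finite cover controls the exponential moment of the signed suprema on a tree: every member of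
the class is replaced by a member of the cover, clipped to the range of the class. -/
lemma sum_exp_signedSup_le [Nonempty ι] (hf : ∀ i e, f i e ∈ Set.Icc 0 M) (hM : 0 ≤ M)
    (hn : 0 < n) (hl : 0 < l) (v : BinTree E n) (V : Finset (BinTree ℝ n))
    (hV : IsSeqCover α (Set.range f) v (V : Set (BinTree ℝ n))) :
    ∑ σ : Fin n → Bool, Real.exp (l * signedSup f M (v.along σ) σ) ≤
      V.card * (2 ^ n * Real.exp (n * (l * α + l ^ 2 * M ^ 2 / 8))) := by
  have hn' : (0 : ℝ) < n := Nat.cast_pos.2 hn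
  let c : BinTree ℝ n → BinTree ℝ n := fun u t s => centredClip M (u t s)
  have hpt : ∀ σ : Fin n → Bool, Real.exp (l * signedSup f M (v.along σ) σ) ≤
      ∑ u ∈ V, Real.exp (n * (l * α)) *
        Real.exp (l * ∑ s, negSign (σ s) * (c u).along σ s) := by
    intro σ
    set R := ∑ u ∈ V, Real.exp (n * (l * α)) *
        Real.exp (l * ∑ s, negSign (σ s) * (c u).along σ s)
    have hi : ∀ i, Real.exp (l * ∑ s, negSign (σ s) * (f i (v.along σ s) - M / 2)) ≤ R := by
      intro i
      obtain ⟨u, huV, hu⟩ := hV (f i) ⟨i, rfl⟩ σ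
      rw [one_div, inv_mul_le_iff₀ hn'] at hu
      refine le_trans ?_ (Finset.single_le_sum (f := fun u => Real.exp (n * (l * α)) *
        Real.exp (l * ∑ s, negSign (σ s) * (c u).along σ s)) (fun _ _ => by positivity)
        (Finset.mem_coe.1 huV))
      rw [← Real.exp_add, Real.exp_le_exp]
      have hd : ∑ s, negSign (σ s) * (f i (v.along σ s) - M / 2) -
          ∑ s, negSign (σ s) * (c u).along σ s ≤ n * α := by
        rw [← Finset.sum_sub_distrib]
        exact (Finset.sum_le_sum fun s _ =>
          sub_centredClip_le (hf i _) (u.along σ s) _ (abs_negSign _)).trans hu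
      nlinarith
    have hR : 0 < R := (Real.exp_pos _).trans_le (hi (Classical.arbitrary ι))
    -- the bound passes to the supremum through the logarithm
    have hs : signedSup f M (v.along σ) σ ≤ Real.log R / l := ciSup_le fun i => by
      rw [le_div_iff₀ hl, mul_comm]
      exact (Real.le_log_iff_exp_le hR).2 (hi i)
    rw [← Real.le_log_iff_exp_le hR, mul_comm]
    exact (le_div_iff₀ hl).1 hs
  refine (Finset.sum_le_sum fun σ _ => hpt σ).trans ?_
  rw [Finset.sum_comm]
  refine (Finset.sum_le_card_nsmul V _ (2 ^ n * Real.exp (n * (l * α + l ^ 2 * M ^ 2 / 8)))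
    fun u _ => ?_).trans_eq (nsmul_eq_mul _ _)
  rw [← Finset.mul_sum]
  refine (mul_le_mul_of_nonneg_left (sum_exp_along_le l (M / 2) n (c u) fun t s =>
    abs_centredClip_le hM _) (Real.exp_pos _).le).trans (le_of_eq ?_)
  rw [mul_left_comm, ← Real.exp_add]
  congr 2
  ring

open scoped ENNReal

lemma sum_exp_signedSup_le_seqCoveringNumber [Nonempty ι] (hf : ∀ i e, f i e ∈ Set.Icc 0 M)
    (hM : 0 ≤ M) (hn : 0 < n) (hl : 0 < l) (v : BinTree E n) :
    (2⁻¹ : ℝ≥0∞) ^ n * ∑ σ : Fin n → Bool,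
        ENNReal.ofReal (Real.exp (l * signedSup f M (v.along σ) σ)) ≤
      ENNReal.ofReal (Real.exp (n * (l * α + l ^ 2 * M ^ 2 / 8))) *
        (seqCoveringNumber α (Set.range f) v : ℝ≥0∞) := by
  set C := Real.exp (n * (l * α + l ^ 2 * M ^ 2 / 8))
  have hC : ENNReal.ofReal C ≠ 0 := by simpa [C] using Real.exp_pos _
  have hmain : ∀ V : Set (BinTree ℝ n), IsSeqCover α (Set.range f) v V →
      (2⁻¹ : ℝ≥0∞) ^ n * ∑ σ : Fin n → Bool,
        ENNReal.ofReal (Real.exp (l * signedSup f M (v.along σ) σ)) ≤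
      ENNReal.ofReal C * (V.encard : ℝ≥0∞) := by
    intro V hV
    by_cases hfin : V.Finite
    · lift V to Finset (BinTree ℝ n) using hfin
      have h := sum_exp_signedSup_le hf hM hn hl v V hV
      rw [← ENNReal.ofReal_sum_of_nonneg fun σ _ => (Real.exp_pos _).le]
      refine (mul_le_mul_right (ENNReal.ofReal_le_ofReal h) _).trans (le_of_eq ?_)
      rw [Set.encard_coe_eq_coe_finsetCard, ENNReal.ofReal_mul (by positivity),
        ENNReal.ofReal_mul (by positivity), ENNReal.ofReal_natCast,
        ENNReal.ofReal_pow (by norm_num), ENNReal.ofReal_ofNat, mul_left_comm, ← mul_assoc (_ ^ n),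
        ← mul_pow, ENNReal.inv_mul_cancel (by norm_num) (by norm_num), one_pow, one_mul, mul_comm]
      rfl
    · rw [Set.Infinite.encard_eq hfin, ENat.toENNReal_top, ENNReal.mul_top hC]
      exact le_top
  rw [mul_comm (ENNReal.ofReal C) (seqCoveringNumber α (Set.range f) v : ℝ≥0∞),
    ← ENNReal.div_le_iff hC ENNReal.ofReal_ne_top,
    seqCoveringNumber, ENat.toENNReal_iInf]
  refine le_iInf fun V => ?_
  rw [ENat.toENNReal_iInf]
  refine le_iInf fun hV => ?_
  rw [ENNReal.div_le_iff hC ENNReal.ofReal_ne_top, mul_comm (V.encard : ℝ≥0∞)]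
  exact hmain V hV

lemma one_le_seqCoveringNumber [Nonempty ι] (v : BinTree E n) :
    1 ≤ seqCoveringNumber α (Set.range f) v := by
  refine le_iInf fun V => le_iInf fun hV => ?_
  obtain ⟨u, hu, -⟩ := hV (f (Classical.arbitrary ι)) ⟨_, rfl⟩ (fun _ => true)
  exact Set.one_le_encard_iff_nonempty.2 ⟨u, hu⟩

/-- The trees with values in a finite grid form a cover: the covering numbers of a bounded class
are bounded uniformly in the tree. -/
lemma exists_seqCoveringNumber_le (hf : ∀ i e, f i e ∈ Set.Icc 0 M) (hα : 0 < α) (n : ℕ) :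
    ∃ K : ℕ, ∀ v : BinTree E n, seqCoveringNumber α (Set.range f) v ≤ K := by
  let G : Set ℝ := (fun k : ℕ => k * α) '' Set.Iic ⌊M / α⌋₊
  have hG : G.Finite := (Set.finite_Iic _).image _
  let V : Set (BinTree ℝ n) := Set.univ.pi fun _ => Set.univ.pi fun _ => G
  have hV : V.Finite := Set.Finite.pi fun _ => Set.Finite.pi fun _ => hG
  refine ⟨V.ncard, fun v => ?_⟩
  rw [Set.Finite.cast_ncard_eq hV]
  refine iInf₂_le V ?_
  rintro _ ⟨i, rfl⟩ σ
  refine ⟨fun t s => ⌊f i (v t s) / α⌋₊ * α, ?_, ?_⟩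
  · refine Set.mem_univ_pi.2 fun t => Set.mem_univ_pi.2 fun s => ⟨_, ?_, rfl⟩
    exact Nat.floor_le_floor (div_le_div_of_nonneg_right (hf i _).2 hα.le)
  · have hb : ∀ b : ℝ, 0 ≤ b → |⌊b / α⌋₊ * α - b| ≤ α := by
      intro b hb
      have h1 := Nat.floor_le (div_nonneg hb hα.le)
      have h2 := Nat.lt_floor_add_one (b / α)
      rw [le_div_iff₀ hα] at h1
      rw [div_lt_iff₀ hα] at h2
      rw [abs_le]
      constructor <;> linarith
    rcases Nat.eq_zero_or_pos n with rfl | hn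
    · simpa using hα.le
    · have hn' : (0 : ℝ) < n := Nat.cast_pos.2 hn
      rw [one_div, inv_mul_le_iff₀ hn']
      refine (Finset.sum_le_card_nsmul Finset.univ _ α fun t _ => hb _ (hf i _).1).trans_eq ?_
      simp

end Covers

/-! ### The tail bound for one series -/

section Tail

open scoped ENNReal

variable {E ι : Type*} {f : ι → E → ℝ} {M : ℝ} {n : ℕ}

/-- The exponential of the largest difference between the sums of the values of the class on two
sequences, given as a sequence of pairs. -/
noncomputable def expSupDiff (f : ι → E → ℝ) (l : ℝ) (q : Fin n → E × E) : ℝ≥0∞ :=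
  ENNReal.ofReal (Real.exp (l * ⨆ i, ∑ s, (f i (q s).2 - f i (q s).1)))

/-- The exponential of the signed supremum along a path of a tree. -/
noncomputable def expSignedSup (f : ι → E → ℝ) (M l : ℝ) (σ : Fin n → Bool) (v : BinTree E n) :
    ℝ≥0∞ :=
  ENNReal.ofReal (Real.exp (l * signedSup f M (v.along σ) σ))

lemma le_iSup_diff (hf : ∀ i e, f i e ∈ Set.Icc 0 M) (q : Fin n → E × E) (i : ι) :
    ∑ s, (f i (q s).2 - f i (q s).1) ≤ ⨆ i, ∑ s, (f i (q s).2 - f i (q s).1) := by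
  refine le_ciSup (f := fun i => ∑ s, (f i (q s).2 - f i (q s).1)) ⟨∑ _s : Fin n, M, ?_⟩ i
  rintro _ ⟨j, rfl⟩
  refine Finset.sum_le_sum fun s _ => ?_
  linarith [(hf j (q s).2).2, (hf j (q s).1).1]

/-- Along a path of a tree of pairs, the two members of the pairs are separated by convexity of the
exponential; the second members form the tree of first members of the reflected tree. -/
lemma expSupDiff_orient_le [Nonempty ι] (hf : ∀ i e, f i e ∈ Set.Icc 0 M) {l : ℝ} (hl : 0 ≤ l)
    (z : BinTree (E × E) n) (σ : Fin n → Bool) :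
    expSupDiff f l (fun s => orient (σ s) (z.along σ s)) ≤
      2⁻¹ * (expSignedSup f M (2 * l) σ z.fst +
        expSignedSup f M (2 * l) (fun s => !σ s) z.reflect.fst) := by
  set A := signedSup f M (z.fst.along σ) σ with hA
  set B := signedSup f M (z.reflect.fst.along (fun s => !σ s)) (fun s => !σ s) with hB
  have hsup : (⨆ i, ∑ s, (f i (orient (σ s) (z.along σ s)).2 -
      f i (orient (σ s) (z.along σ s)).1)) ≤ A + B := by
    refine ciSup_le fun i => ?_
    refine le_trans (le_of_eq ?_) (add_le_add (le_signedSup hf (z.fst.along σ) σ i)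
      (le_signedSup hf (z.reflect.fst.along (fun s => !σ s)) (fun s => !σ s) i))
    rw [← Finset.sum_add_distrib]
    refine Finset.sum_congr rfl fun s _ => ?_
    have h2 : z.reflect.fst.along (fun s => !σ s) s = (z.along σ s).2 := by
      simp [BinTree.along, BinTree.fst, BinTree.reflect]
    have h1 : z.fst.along σ s = (z.along σ s).1 := rfl
    rw [h1, h2]
    cases σ s <;> simp [orient, negSign]
  have hexp : Real.exp (l * (A + B)) ≤ 2⁻¹ * (Real.exp (2 * l * A) + Real.exp (2 * l * B)) := by
    have e1 : Real.exp (2 * l * A) = Real.exp (l * A) ^ 2 := by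
      rw [← Real.exp_nat_mul]; congr 1; push_cast; ring
    have e2 : Real.exp (2 * l * B) = Real.exp (l * B) ^ 2 := by
      rw [← Real.exp_nat_mul]; congr 1; push_cast; ring
    rw [mul_add, Real.exp_add, e1, e2]
    nlinarith [sq_nonneg (Real.exp (l * A) - Real.exp (l * B))]
  have h : expSupDiff f l (fun s => orient (σ s) (z.along σ s)) ≤
      ENNReal.ofReal (2⁻¹ * (Real.exp (2 * l * A) + Real.exp (2 * l * B))) :=
    ENNReal.ofReal_le_ofReal
      ((Real.exp_le_exp.2 (mul_le_mul_of_nonneg_left hsup hl)).trans hexp)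
  refine h.trans (le_of_eq ?_)
  rw [ENNReal.ofReal_mul (by norm_num), ENNReal.ofReal_add (Real.exp_pos _).le (Real.exp_pos _).le,
    ENNReal.ofReal_inv_of_pos (by norm_num), ENNReal.ofReal_ofNat]
  rfl

variable [MeasurableSpace E]

/-- The class `f` is universally measurable: the suprema of linear combinations of its values at
finitely many points are. -/
def IsMeasurableClass (f : ι → E → ℝ) : Prop :=
  ∀ (n : ℕ) (c : Fin n → ℝ), UniversallyMeasurable (fun x : Fin n → E => ⨆ i, ∑ k, c k * f i (x k))

lemma universallyMeasurable_expSupDiff (hU : IsMeasurableClass f) (l : ℝ) :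
    UniversallyMeasurable (expSupDiff f l : (Fin n → E × E) → ℝ≥0∞) := by
  have hm : Measurable (fun q : Fin n → E × E =>
      (Fin.append (fun s => (q s).1) (fun s => (q s).2) : Fin (n + n) → E)) := by
    refine measurable_pi_lambda _ fun k => ?_
    refine Fin.addCases (fun k => ?_) (fun k => ?_) k
    · simp only [Fin.append_left]
      exact measurable_fst.comp (measurable_pi_apply k)
    · simp only [Fin.append_right]
      exact measurable_snd.comp (measurable_pi_apply k)
  have h := (hU (n + n) (Fin.append (fun _ => -1) (fun _ => 1))).comp_measurable hm
  have h2 := h.measurable_comp (g := fun a => ENNReal.ofReal (Real.exp (l * a))) (by fun_prop)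
  have e : ∀ (i : ι) (q : Fin n → E × E), ∑ k : Fin (n + n),
      (Fin.append (fun _ => -1) (fun _ => 1) : Fin (n + n) → ℝ) k *
        f i ((Fin.append (fun s => (q s).1) (fun s => (q s).2) : Fin (n + n) → E) k) =
      ∑ s, (f i (q s).2 - f i (q s).1) := by
    intro i q
    rw [Fin.sum_univ_add]
    simp only [Fin.append_left, Fin.append_right, ← Finset.sum_add_distrib]
    exact Finset.sum_congr rfl fun s _ => by ring
  simp only [e] at h2
  exact h2

lemma universallyMeasurable_expSignedSup [Nonempty ι] (hU : IsMeasurableClass f)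
    (hf : ∀ i e, f i e ∈ Set.Icc 0 M) (l : ℝ) (σ : Fin n → Bool) :
    UniversallyMeasurable (expSignedSup f M l σ : BinTree E n → ℝ≥0∞) := by
  have h := (hU n (fun s => negSign (σ s))).comp_measurable (BinTree.measurable_along σ)
  have h2 := h.measurable_comp (g := fun a => ENNReal.ofReal
    (Real.exp (l * (a - ∑ s, negSign (σ s) * (M / 2))))) (by fun_prop)
  simp only [← signedSup_eq hf] at h2
  exact h2

variable (κ : (t : ℕ) → Kernel (Fin t → E) E) [∀ t, IsMarkovKernel (κ t)]

/-- The exponential moment of the supremum of the decoupled differences is controlled by the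
expected covering number on the random tree. The covering number need not be measurable: its
Lebesgue integral is a lower integral, which suffices for an upper bound of a measurable
function. -/
lemma lintegral_expSupDiff_le [Nonempty ι] (hU : IsMeasurableClass f)
    (hf : ∀ i e, f i e ∈ Set.Icc 0 M) (hM : 0 ≤ M) (hn : 0 < n) {l : ℝ} (hl : 0 < l) (α : ℝ)
    (t : ℕ) (x : Fin t → E) :
    ∫⁻ y, ∫⁻ w, expSupDiff f l (fun s => (y s, w s)) ∂(decoupledLaw κ n t (x, y))
        ∂(pathLaw κ n t x) ≤
      ENNReal.ofReal (Real.exp (n * (2 * l * α + l ^ 2 * M ^ 2 / 2))) *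
        ∫⁻ v, (seqCoveringNumber α (Set.range f) v : ℝ≥0∞)
          ∂((pairTreeLaw κ n t x).map BinTree.fst) := by
  rw [lintegral_path_decoupled κ n t x (universallyMeasurable_expSupDiff hU l)]
  set P := pairTreeLaw κ n t x
  have hprob : IsProbabilityMeasure (P.map BinTree.fst) :=
    Measure.isProbabilityMeasure_map BinTree.measurable_fst.aemeasurable
  have hg : ∀ σ : Fin n → Bool, UniversallyMeasurable (expSignedSup f M (2 * l) σ) :=
    universallyMeasurable_expSignedSup hU hf _
  let I : (Fin n → Bool) → ℝ≥0∞ := fun σ =>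
    ∫⁻ v, expSignedSup f M (2 * l) σ v ∂(P.map BinTree.fst)
  have hI : ∀ σ, ∫⁻ z, expSignedSup f M (2 * l) σ z.fst ∂P = I σ := fun σ =>
    (lintegral_map' (hg σ _ hprob) BinTree.measurable_fst.aemeasurable).symm
  have hI' : ∀ σ, ∫⁻ z, expSignedSup f M (2 * l) σ z.reflect.fst ∂P = I σ := fun σ =>
    (lintegral_pairTreeLaw_reflect κ n t x
      ((hg σ).comp_measurable BinTree.measurable_fst)).trans (hI σ)
  have hσ : ∀ σ : Fin n → Bool,
      ∫⁻ z, expSupDiff f l (fun s => orient (σ s) (z.along σ s)) ∂P ≤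
        2⁻¹ * (I σ + I (fun s => !σ s)) := by
    intro σ
    refine (lintegral_mono fun z => expSupDiff_orient_le hf hl.le z σ).trans_eq ?_
    rw [lintegral_const_mul' _ _ (by simp),
      lintegral_add_left' ((hg σ).comp_measurable BinTree.measurable_fst _ inferInstance), hI, hI']
  have hflip : ∑ σ : Fin n → Bool, I (fun s => !σ s) = ∑ σ, I σ :=
    (Equiv.piCongrRight fun _ : Fin n => Equiv.boolNot).sum_comp I
  calc (2⁻¹ : ℝ≥0∞) ^ n * ∑ σ : Fin n → Bool,
        ∫⁻ z, expSupDiff f l (fun s => orient (σ s) (z.along σ s)) ∂P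
      ≤ (2⁻¹ : ℝ≥0∞) ^ n * ∑ σ : Fin n → Bool, 2⁻¹ * (I σ + I (fun s => !σ s)) := by
        gcongr with σ
        exact hσ σ
    _ = (2⁻¹ : ℝ≥0∞) ^ n * ∑ σ, I σ := by
        rw [← Finset.mul_sum, Finset.sum_add_distrib, hflip, mul_add, ← add_mul,
          ENNReal.inv_two_add_inv_two, one_mul]
    _ = ∫⁻ v, (2⁻¹ : ℝ≥0∞) ^ n * ∑ σ, expSignedSup f M (2 * l) σ v ∂(P.map BinTree.fst) := by
        rw [lintegral_const_mul' _ _ (by simp), lintegral_finsetSum' _ fun σ _ => hg σ _ hprob]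
    _ ≤ ∫⁻ v, ENNReal.ofReal (Real.exp (n * (2 * l * α + l ^ 2 * M ^ 2 / 2))) *
          (seqCoveringNumber α (Set.range f) v : ℝ≥0∞) ∂(P.map BinTree.fst) := by
        refine lintegral_mono fun v => ?_
        refine (sum_exp_signedSup_le_seqCoveringNumber (α := α) hf hM hn (l := 2 * l)
          (by positivity) v).trans_eq ?_
        congr 4
        ring
    _ = _ := lintegral_const_mul' _ _ ENNReal.ofReal_ne_top

variable {Ω : Type*} [MeasurableSpace Ω] [StandardBorelSpace E] [Nonempty E]

/-- The tail bound for one series, before the choice of the parameter `l` of the exponential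
moment. -/
theorem measure_exists_lt_sum_condMean_sub_le [Nonempty ι] (μ : Measure Ω) [IsProbabilityMeasure μ]
    {W : ℕ → Ω → E} (hW : ∀ t, Measurable (W t)) (hU : IsMeasurableClass f)
    (hfm : ∀ i, Measurable (f i)) (hf : ∀ i e, f i e ∈ Set.Icc 0 M) (hM : 0 ≤ M) (hn : 0 < n)
    {l : ℝ} (hl : 0 < l) (α r : ℝ) :
    μ {ω | ∃ i, n * (2 * α + r) <
        ∑ s ∈ Finset.range n, (condMean μ W (f i) s ω - f i (W s ω))} ≤
      ENNReal.ofReal (Real.exp (n * (l ^ 2 * M ^ 2 / 2 - l * r))) *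
        ∫⁻ v, (seqCoveringNumber α (Set.range f) v : ℝ≥0∞) ∂(treeLaw μ W n) := by
  set κ := condLaw μ W
  -- the conditional exponential moment given the path, which unlike the supremum of the deviations
  -- is universally measurable, so that Markov's inequality applies to it
  let K : (Fin 0 → E) × (Fin n → E) → ℝ≥0∞ := fun p =>
    ∫⁻ w, expSupDiff f l (fun s => (p.2 s, w s)) ∂(decoupledLaw κ n 0 p)
  have hK : UniversallyMeasurable K :=
    ((universallyMeasurable_expSupDiff hU l).comp_measurable
      (g := fun q : ((Fin 0 → E) × (Fin n → E)) × (Fin n → E) => fun s => (q.1.2 s, q.2 s))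
      (by fun_prop)).lintegral_kernel (decoupledLaw κ n 0)
  let path : Ω → (Fin 0 → E) × (Fin n → E) := fun ω => (fun k => W k ω, fun s => W (0 + s) ω)
  have hpath : Measurable path := Measurable.prodMk (measurable_pi_lambda _ fun _ => hW _)
    (measurable_pi_lambda _ fun _ => hW _)
  set c := n * (2 * α + r)
  have hsub : {ω | ∃ i, c < ∑ s ∈ Finset.range n, (condMean μ W (f i) s ω - f i (W s ω))} ⊆
      {ω | ENNReal.ofReal (Real.exp (l * c)) ≤ K (path ω)} := by
    rintro ω ⟨i, hi⟩
    have h1 := exp_sum_seqMean_le κ (hfm i) (hf i) l (fun t => W t ω) n 0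
    refine le_trans (le_trans (ENNReal.ofReal_le_ofReal (Real.exp_le_exp.2
      (mul_le_mul_of_nonneg_left (hi.le.trans_eq ?_) hl.le))) h1) (lintegral_mono fun u => ?_)
    · simp only [zero_add]
      rfl
    · exact ENNReal.ofReal_le_ofReal (Real.exp_le_exp.2 (mul_le_mul_of_nonneg_left
        (le_iSup_diff hf (fun s => (W (0 + s) ω, u s)) i) hl.le))
  have hint : ∫⁻ ω, K (path ω) ∂μ ≤
      ENNReal.ofReal (Real.exp (n * (2 * l * α + l ^ 2 * M ^ 2 / 2))) *
        ∫⁻ v, (seqCoveringNumber α (Set.range f) v : ℝ≥0∞) ∂(treeLaw μ W n) := by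
    rw [← lintegral_pathLaw_condLaw μ hW n 0 hK]
    have he : ∀ ω, (fun k : Fin 0 => W k ω) = fun k => k.elim0 := fun ω => Subsingleton.elim _ _
    simp only [he, lintegral_const, measure_univ, mul_one]
    exact lintegral_expSupDiff_le κ hU hf hM hn hl α 0 _
  have hmarkov := mul_meas_ge_le_lintegral₀ ((hK.comp_measurable hpath) μ inferInstance)
    (ENNReal.ofReal (Real.exp (l * c)))
  have hfin : ENNReal.ofReal (Real.exp (l * c)) * μ {ω | ∃ i, c < ∑ s ∈ Finset.range n,
      (condMean μ W (f i) s ω - f i (W s ω))} ≤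
      ENNReal.ofReal (Real.exp (l * c)) *
        (ENNReal.ofReal (Real.exp (n * (l ^ 2 * M ^ 2 / 2 - l * r))) *
        ∫⁻ v, (seqCoveringNumber α (Set.range f) v : ℝ≥0∞) ∂(treeLaw μ W n)) := by
    refine (mul_le_mul_right (measure_mono hsub) _).trans ((hmarkov.trans hint).trans_eq ?_)
    rw [← mul_assoc, ← ENNReal.ofReal_mul (Real.exp_pos _).le, ← Real.exp_add]
    congr 3
    simp only [c]
    ring
  exact (ENNReal.mul_le_mul_iff_right (by simpa using Real.exp_pos _)
    ENNReal.ofReal_ne_top).1 hfin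

end Tail

/-! ### Choice of parameters and uniformity in the scale of the covers -/

section Parameters

open scoped ENNReal

variable {Ω E ι : Type*} [MeasurableSpace Ω]

/-- A tail bound at every threshold of a family holds at all of them simultaneously. No
measurability is needed, the measure of an increasing union being the supremum of the measures. -/
lemma measure_exists_lt_le [Nonempty ι] (μ : Measure Ω) {B : ι → ℝ} (hB : BddBelow (Set.range B))
    (D : Ω → ℝ) {c : ℝ≥0∞} (h : ∀ i, μ {ω | B i < D ω} ≤ c) : μ {ω | ∃ i, B i < D ω} ≤ c := by
  obtain ⟨u, hu, hub, hlim⟩ := exists_seq_strictAnti_tendsto (⨅ i, B i)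
  have hset : {ω | ∃ i, B i < D ω} = ⋃ n, {ω | u n < D ω} := by
    ext ω
    simp only [Set.mem_ofPred_eq, Set.mem_iUnion]
    constructor
    · rintro ⟨i, hi⟩
      exact (hlim.eventually_lt_const ((ciInf_le hB i).trans_lt hi)).exists
    · rintro ⟨n, hn⟩
      exact exists_lt_of_ciInf_lt ((hub n).trans hn)
  have hmono : Monotone fun n => {ω | u n < D ω} :=
    fun a b hab ω hω => (hu.antitone hab).trans_lt hω
  rw [hset, hmono.measure_iUnion]
  refine iSup_le fun n => ?_
  obtain ⟨i, hi⟩ := exists_lt_of_ciInf_lt (hub n)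
  exact (measure_mono fun ω hω => hi.trans hω).trans (h i)

variable [MeasurableSpace E] [StandardBorelSpace E] [Nonempty E] {f : ι → E → ℝ} {M α : ℝ} {n : ℕ}

lemma isProbabilityMeasure_treeLaw (μ : Measure Ω) [IsProbabilityMeasure μ] (W : ℕ → Ω → E)
    (n : ℕ) : IsProbabilityMeasure (treeLaw μ W n) :=
  Measure.isProbabilityMeasure_map BinTree.measurable_fst.aemeasurable

lemma ofReal_expCovering (μ : Measure Ω) [IsProbabilityMeasure μ] (W : ℕ → Ω → E)
    (hf : ∀ i e, f i e ∈ Set.Icc 0 M) (hα : 0 < α) :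
    ENNReal.ofReal (expCovering μ W n α (Set.range f)) =
      ∫⁻ v, (seqCoveringNumber α (Set.range f) v : ℝ≥0∞) ∂(treeLaw μ W n) := by
  have := isProbabilityMeasure_treeLaw μ W n
  obtain ⟨K, hK⟩ := exists_seqCoveringNumber_le hf hα n
  refine ENNReal.ofReal_toReal (ne_top_of_le_ne_top (ENNReal.natCast_ne_top K) ?_)
  calc ∫⁻ v, (seqCoveringNumber α (Set.range f) v : ℝ≥0∞) ∂(treeLaw μ W n)
      ≤ ∫⁻ _, (K : ℝ≥0∞) ∂(treeLaw μ W n) :=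
        lintegral_mono fun v => by simpa using ENat.toENNReal_le.2 (hK v)
    _ = K := by simp

lemma one_le_expCovering [Nonempty ι] (μ : Measure Ω) [IsProbabilityMeasure μ] (W : ℕ → Ω → E)
    (hf : ∀ i e, f i e ∈ Set.Icc 0 M) (hα : 0 < α) :
    1 ≤ expCovering μ W n α (Set.range f) := by
  have := isProbabilityMeasure_treeLaw μ W n
  rw [← ENNReal.one_le_ofReal, ofReal_expCovering μ W hf hα]
  calc (1 : ℝ≥0∞) = ∫⁻ _, 1 ∂(treeLaw μ W n) := by simp
    _ ≤ _ := lintegral_mono fun v => by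
        simpa using ENat.toENNReal_le.2 (one_le_seqCoveringNumber v)

lemma condMean_mem_Icc (μ : Measure Ω) [IsProbabilityMeasure μ] (W : ℕ → Ω → E) {g : E → ℝ}
    (hg : ∀ e, g e ∈ Set.Icc 0 M) (t : ℕ) (ω : Ω) : condMean μ W g t ω ∈ Set.Icc 0 M := by
  refine ⟨integral_nonneg fun e => (hg e).1, (le_abs_self _).trans ?_⟩
  have h := norm_integral_le_of_norm_le_const (μ := condLaw μ W t (fun s : Fin t => W s ω))
    (f := g) (C := M) (.of_forall fun e => by rw [Real.norm_of_nonneg (hg e).1]; exact (hg e).2)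
  simpa [condMean] using h

/-- The tail bound for one series, with the optimal exponential parameter `l = r / M ^ 2` for the
deviation `r = M √(2 A / n)`. -/
theorem measure_exists_lt_mean_condMean_sub_le [Nonempty ι] (μ : Measure Ω)
    [IsProbabilityMeasure μ] {W : ℕ → Ω → E} (hW : ∀ t, Measurable (W t))
    (hU : IsMeasurableClass f) (hfm : ∀ i, Measurable (f i)) (hf : ∀ i e, f i e ∈ Set.Icc 0 M)
    (hM : 0 ≤ M) (hn : 0 < n) (hα : 0 < α) {A : ℝ} (hA : 0 < A) :
    μ {ω | ∃ i, 2 * α + M * Real.sqrt (2 / n * A) <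
        (1 / (n : ℝ)) * ∑ s ∈ Finset.range n, (condMean μ W (f i) s ω - f i (W s ω))} ≤
      ENNReal.ofReal (Real.exp (-A) * expCovering μ W n α (Set.range f)) := by
  have hn' : (0 : ℝ) < n := Nat.cast_pos.2 hn
  rw [ENNReal.ofReal_mul (Real.exp_pos _).le, ofReal_expCovering μ W hf hα]
  rcases hM.eq_or_lt with rfl | hM
  · -- the class vanishes, hence so do the deviations
    have hempty : {ω | ∃ i, 2 * α + 0 * Real.sqrt (2 / n * A) <
        (1 / (n : ℝ)) * ∑ s ∈ Finset.range n, (condMean μ W (f i) s ω - f i (W s ω))} = ∅ := by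
      refine Set.eq_empty_of_forall_notMem ?_
      rintro ω ⟨i, hi⟩
      have : ∑ s ∈ Finset.range n, (condMean μ W (f i) s ω - f i (W s ω)) ≤ 0 :=
        Finset.sum_nonpos fun s _ => by
          linarith [(condMean_mem_Icc μ W (hf i) s ω).2, (hf i (W s ω)).1]
      have := mul_nonpos_of_nonneg_of_nonpos (one_div_nonneg.2 hn'.le) this
      linarith
    rw [hempty, measure_empty]
    exact zero_le
  · set r := M * Real.sqrt (2 / n * A) with hr
    have hr0 : 0 < r := by positivity
    have hr2 : r ^ 2 = M ^ 2 * (2 / n * A) := by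
      rw [hr, mul_pow, Real.sq_sqrt (by positivity)]
    have hb := measure_exists_lt_sum_condMean_sub_le μ hW hU hfm hf hM.le hn
      (l := r / M ^ 2) (by positivity) α r
    have hexp : n * ((r / M ^ 2) ^ 2 * M ^ 2 / 2 - r / M ^ 2 * r) = -A := by
      have : n * ((r / M ^ 2) ^ 2 * M ^ 2 / 2 - r / M ^ 2 * r) = -(n * r ^ 2 / (2 * M ^ 2)) := by
        field_simp
        ring
      rw [this, hr2]
      field_simp
    rw [hexp] at hb
    refine (measure_mono ?_).trans hb
    rintro ω ⟨i, hi⟩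
    refine ⟨i, ?_⟩
    rwa [one_div, lt_inv_mul_iff₀ hn'] at hi

end Parameters

/-! ### Local models -/

section Local

open scoped ENNReal

variable {Ω 𝒴 : Type*} [MeasurableSpace Ω] [MeasurableSpace 𝒴] {m p : ℕ}

lemma measurable_infoProcess {Y : ℤ → Fin m → Ω → 𝒴} (hY : ∀ t i, Measurable (Y t i))
    (J : Finset (Fin m)) (t : ℕ) : Measurable (infoProcess p Y J t) :=
  measurable_pi_lambda _ fun _ => Measurable.prodMk (measurable_pi_lambda _ fun _ => hY _ _)
    (hY _ _)

lemma isMeasurableClass_lossAt {L : 𝒴 → 𝒴 → ℝ} {H : Set ((Fin p → 𝒴) → 𝒴)}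
    (hF : IsMeasurableLossClass L H) {J : Finset (Fin m)} {i : Fin m} (hi : i ∈ J) :
    IsMeasurableClass (fun h : H => lossAt L hi (h : (Fin p → 𝒴) → 𝒴)) := by
  intro n c
  have h : UniversallyMeasurable (fun x : Fin n → (Fin p → 𝒴) × 𝒴 =>
      ⨆ h : H, ∑ k, c k * loss L (h : (Fin p → 𝒴) → 𝒴) (x k)) := fun ν hν => hF n c ν
  exact h.comp_measurable (g := fun x : Fin n → J → (Fin p → 𝒴) × 𝒴 => fun k => x k ⟨i, hi⟩)
    (by fun_prop)

variable [StandardBorelSpace 𝒴] [Nonempty 𝒴]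

/-- If no series deviates from its conditional means by more than `B` on average, then the gap
exceeds the mean discrepancy by at most `B`. -/
lemma gapLoc_le (μ : Measure Ω) [IsProbabilityMeasure μ] {T : ℕ} (hm : 0 < m) {L : 𝒴 → 𝒴 → ℝ}
    {M : ℝ} (hLM : ∀ y y', L y y' ∈ Set.Icc 0 M) (Y : ℤ → Fin m → Ω → 𝒴)
    {H : Set ((Fin p → 𝒴) → 𝒴)} (hH : H.Nonempty) {J : Fin m → Finset (Fin m)}
    (hJ : ∀ i, i ∈ J i) {B : ℝ} {ω : Ω}
    (hB : ∀ i, ∀ h : H, (1 / (T : ℝ)) * ∑ t ∈ Finset.range T,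
      (condMean μ (infoProcess p Y (J i)) (lossAt L (hJ i) (h : (Fin p → 𝒴) → 𝒴)) t ω
        - lossAt L (hJ i) (h : (Fin p → 𝒴) → 𝒴) (infoProcess p Y (J i) t ω)) ≤ B) :
    gapLoc μ T L Y hJ H ω ≤ (1 / (m : ℝ)) * ∑ i, discrepancy μ T L Y (hJ i) H ω + B := by
  have hm' : (0 : ℝ) < m := Nat.cast_pos.2 hm
  have := hH.to_subtype
  have hmean : ∀ i (h : H) t, condMean μ (infoProcess p Y (J i))
      (lossAt L (hJ i) (h : (Fin p → 𝒴) → 𝒴)) t ω ∈ Set.Icc 0 M :=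
    fun i h t => condMean_mem_Icc μ _ (fun _ => hLM _ _) t ω
  refine ciSup_le fun h => ?_
  have hi : ∀ i, condMean μ (infoProcess p Y (J i))
        (lossAt L (hJ i) (h i : (Fin p → 𝒴) → 𝒴)) T ω
      - (1 / (T : ℝ)) * ∑ t ∈ Finset.range T,
        loss L (h i : (Fin p → 𝒴) → 𝒴) (localExample p Y i t ω) ≤
      discrepancy μ T L Y (hJ i) H ω + B := by
    intro i
    have hbdd : BddAbove (Set.range fun g : H => condMean μ (infoProcess p Y (J i))
          (lossAt L (hJ i) (g : (Fin p → 𝒴) → 𝒴)) T ω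
        - (1 / (T : ℝ)) * ∑ t ∈ Finset.range T, condMean μ (infoProcess p Y (J i))
          (lossAt L (hJ i) (g : (Fin p → 𝒴) → 𝒴)) t ω) := by
      refine ⟨M, ?_⟩
      rintro _ ⟨g, rfl⟩
      have h1 : 0 ≤ (1 / (T : ℝ)) * ∑ t ∈ Finset.range T, condMean μ (infoProcess p Y (J i))
          (lossAt L (hJ i) (g : (Fin p → 𝒴) → 𝒴)) t ω :=
        mul_nonneg (by positivity) (Finset.sum_nonneg fun t _ => (hmean i g t).1)
      exact (sub_le_self _ h1).trans (hmean i g T).2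
    have h2 := le_ciSup hbdd (h i)
    have h3 := hB i (h i)
    rw [Finset.sum_sub_distrib, mul_sub] at h3
    have h4 := add_le_add h2 h3
    rw [sub_add_sub_cancel] at h4
    exact h4
  have hsum := Finset.sum_le_sum fun i (_ : i ∈ Finset.univ) => hi i
  rw [Finset.sum_sub_distrib, Finset.sum_add_distrib, ← Finset.mul_sum, Finset.sum_const,
    Finset.card_univ, Fintype.card_fin, nsmul_eq_mul] at hsum
  have hdiv := mul_le_mul_of_nonneg_left hsum (one_div_nonneg.2 hm'.le)
  rw [mul_sub, mul_add, ← mul_assoc, ← mul_assoc, one_div_mul_one_div, one_div_mul_cancel hm'.ne',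
    one_mul] at hdiv
  exact hdiv

end Local

end LocalForecast

open LocalForecast in
theorem mainTheorem3
    {Ω 𝒴 : Type*} [MeasurableSpace Ω] [MeasurableSpace 𝒴] [StandardBorelSpace 𝒴] [Nonempty 𝒴]
    (μ : Measure Ω) [IsProbabilityMeasure μ]
    (m T p : ℕ) (hm : 0 < m) (hT : 0 < T)
    (Y : ℤ → Fin m → Ω → 𝒴) (hY : ∀ t i, Measurable (Y t i))
    (M : ℝ) (L : 𝒴 → 𝒴 → ℝ) (hL : Measurable (fun q : 𝒴 × 𝒴 => L q.1 q.2))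
    (hLM : ∀ y y', 0 ≤ L y y' ∧ L y y' ≤ M)
    (H : Set ((Fin p → 𝒴) → 𝒴)) (hH : H.Nonempty) (hHm : ∀ h ∈ H, Measurable h)
    (hF : LocalForecast.IsMeasurableLossClass L H)
    (J : Fin m → Finset (Fin m)) (hJ : ∀ i, i ∈ J i)
    (δ : ℝ) (hδ : 0 < δ) :
    μ {ω | ¬ ∀ α : ℝ, 0 < α →
        LocalForecast.gapLoc μ T L Y hJ H ω ≤
          (1 / (m : ℝ)) * ∑ i, LocalForecast.discrepancy μ T L Y (hJ i) H ω
            + 2 * α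
            + M * Real.sqrt ((2 / (T : ℝ)) *
                Real.log ((m : ℝ) * (⨆ i, LocalForecast.localCovering μ T L Y (hJ i) H α) / δ))}
      ≤ ENNReal.ofReal δ := by
  -- for `δ < 1` the logarithms below are positive
  rcases le_or_gt 1 δ with hδ1 | hδ1
  · exact prob_le_one.trans (ENNReal.one_le_ofReal.2 hδ1)
  have hm' : (0 : ℝ) < m := Nat.cast_pos.2 hm
  have hM : 0 ≤ M := (hLM (Classical.arbitrary 𝒴) (Classical.arbitrary 𝒴)).1.trans
    (hLM (Classical.arbitrary 𝒴) (Classical.arbitrary 𝒴)).2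
  have := hH.to_subtype
  have : Nonempty (Fin m) := ⟨⟨0, hm⟩⟩
  have hf : ∀ i, ∀ (h : H) (w : J i → (Fin p → 𝒴) × 𝒴),
      lossAt L (hJ i) (h : (Fin p → 𝒴) → 𝒴) w ∈ Set.Icc 0 M := fun i h w => hLM _ _
  have hfm : ∀ i, ∀ h : H, Measurable (lossAt L (hJ i) (h : (Fin p → 𝒴) → 𝒴)) := by
    intro i h
    have h1 : Measurable fun w : J i → (Fin p → 𝒴) × 𝒴 => w ⟨i, hJ i⟩ := measurable_pi_apply _
    exact hL.comp (((hHm h h.2).comp h1.fst).prodMk h1.snd)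
  have hcov : ∀ i α, localCovering μ T L Y (hJ i) H α = expCovering μ (infoProcess p Y (J i)) T α
      (Set.range fun h : H => lossAt L (hJ i) (h : (Fin p → 𝒴) → 𝒴)) := fun i α => by
    rw [localCovering, Set.image_eq_range]
  let N : ℝ → ℝ := fun α => ⨆ i, localCovering μ T L Y (hJ i) H α
  have hN : ∀ α i, localCovering μ T L Y (hJ i) H α ≤ N α := fun α i =>
    le_ciSup (f := fun i => localCovering μ T L Y (hJ i) H α) (Set.finite_range _).bddAbove i
  let B : {α : ℝ // 0 < α} → ℝ := fun α =>
    2 * α + M * Real.sqrt ((2 / (T : ℝ)) * Real.log ((m : ℝ) * N α / δ))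
  let D : Ω → ℝ := fun ω => gapLoc μ T L Y hJ H ω
    - (1 / (m : ℝ)) * ∑ i, discrepancy μ T L Y (hJ i) H ω
  have hset : {ω | ¬ ∀ α : ℝ, 0 < α →
        gapLoc μ T L Y hJ H ω ≤ (1 / (m : ℝ)) * ∑ i, discrepancy μ T L Y (hJ i) H ω + 2 * α
            + M * Real.sqrt ((2 / (T : ℝ)) * Real.log ((m : ℝ) * N α / δ))} =
      {ω | ∃ α, B α < D ω} := by
    ext ω
    simp only [Set.mem_ofPred_eq, not_forall, not_le, Subtype.exists, B, D, exists_prop]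
    refine exists_congr fun α => and_congr_right fun _ => ?_
    rw [lt_sub_iff_add_lt', ← add_assoc]
  have : Nonempty {α : ℝ // 0 < α} := ⟨⟨1, one_pos⟩⟩
  refine (congrArg μ hset).trans_le (measure_exists_lt_le μ ⟨0, ?_⟩ D fun α => ?_)
  · rintro _ ⟨α, rfl⟩
    have := α.2
    positivity
  have hN1 : 1 ≤ N α := by
    refine le_trans ?_ (hN α ⟨0, hm⟩)
    rw [hcov]
    exact one_le_expCovering μ _ (hf _) α.2
  have hN0 : 0 < N α := one_pos.trans_le hN1
  set A := Real.log ((m : ℝ) * N α / δ) with hA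
  have hA0 : 0 < A := by
    refine Real.log_pos ((one_lt_div hδ).2 (hδ1.trans_le ?_))
    exact one_le_mul_of_one_le_of_one_le (Nat.one_le_cast.2 hm) hN1
  have hsub : {ω | B α < D ω} ⊆ ⋃ i, {ω | ∃ h : H, 2 * (α : ℝ) + M * Real.sqrt (2 / T * A) <
      (1 / (T : ℝ)) * ∑ t ∈ Finset.range T,
      (condMean μ (infoProcess p Y (J i)) (lossAt L (hJ i) (h : (Fin p → 𝒴) → 𝒴)) t ω
        - lossAt L (hJ i) (h : (Fin p → 𝒴) → 𝒴) (infoProcess p Y (J i) t ω))} := by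
    intro ω hω
    by_contra hcon
    simp only [Set.mem_iUnion, Set.mem_ofPred_eq, not_exists, not_lt] at hcon
    have hgap := gapLoc_le μ hm hLM Y hH hJ hcon
    simp only [Set.mem_ofPred_eq, B, D] at hω
    linarith
  have hexp : Real.exp (-A) = δ / (m * N α) := by
    rw [Real.exp_neg, hA, Real.exp_log (by positivity), inv_div]
  calc μ {ω | B α < D ω} ≤ ∑ i : Fin m, ENNReal.ofReal (δ / m) := by
        refine (measure_mono hsub).trans ((measure_iUnion_fintype_le μ _).trans
          (Finset.sum_le_sum fun i _ => ?_))
        refine (measure_exists_lt_mean_condMean_sub_le μ (measurable_infoProcess hY (J i))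
          (isMeasurableClass_lossAt hF (hJ i)) (hfm i) (hf i) hM hT α.2 hA0).trans
          (ENNReal.ofReal_le_ofReal ?_)
        rw [← hcov, hexp]
        refine (mul_le_mul_of_nonneg_left (hN α i) (by positivity)).trans_eq ?_
        field_simp
    _ = ENNReal.ofReal δ := by
        rw [← ENNReal.ofReal_sum_of_nonneg fun _ _ => by positivity, Finset.sum_const,
          Finset.card_univ, Fintype.card_fin, nsmul_eq_mul, mul_div_cancel₀ _ hm'.ne']
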